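/- Let $k\ge 1$, let $e_1$ be the first standard basis vector of $\mathbb R^k$, let $\alpha\in(0,1)$, and let $z_{1-\alpha/2}$ be the $1-\alpha/2$ quantile of the standard normal distribution. For each sample size $n\ge 1$ let $\mathcal F_n$ be a nonempty parameter space. Each $F\in\mathcal F_n$ has a true parameter $\theta_F\in\mathbb R^k$ and specifies the joint distribution $P_F$ of an estimator $\hat\theta\in\mathbb R^k$ and a symmetric random matrix $\hat V\in\mathbb R^{k\times k}$ (both depending on $n$). The inequality is $g(\theta)\le 0$, where $g$ is a real-valued function on $\mathbb R^k$; let $G$ be its gradient (where $g$ is not differentiable, the values of $G$ are arbitrary). Put $\hat a=G(\hat\theta)$ and $$\hat s=n^{-1/2}(e_1'\hat Ve_1)^{1/2},\qquad \ddot\theta=\hat\theta-\hat V\hat a(\hat a'\hat V\hat a)^{-1}g(\hat\theta),$$ $$\ddot s=n^{-1/2}\bigl(e_1'\hat Ve_1-e_1'\hat V\hat a(\hat a'\hat V\hat a)^{-1}\hat a'\hat Ve_1\bigr)^{1/2},$$ $$\ddot c=(e_1'\hat V\hat a)^{-1}(\hat a'\hat V\hat a)(\hat s-\ddot s)z_{1-\alpha/2}\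 \text{ if } e_1'\hat V\hat a\ne 0,\qquad \ddot c=0\ \text{ otherwise}.$$ The inequality-imposed confidence interval is $IICI=[\ell,u]$, where $\ell=e_1'\hat\theta-\hat sz_{1-\alpha/2}$ if $g(\hat\theta)\le\ddot c$ and $\ell=e_1'\ddot\theta-\ddot sz_{1-\alpha/2}$ if $g(\hat\theta)>\ddot c$, while $u=e_1'\hat\theta+\hat sz_{1-\alpha/2}$ if $g(\hat\theta)\le-\ddot c$ and $u=e_1'\ddot\theta+\ddot sz_{1-\alpha/2}$ if $g(\hat\theta)>-\ddot c$. Assume: (1) For every sequence $F_n\in\mathcal F_n$ and every subsequence $n_m$ there are a further subsequence $n_q$ and a symmetric positive definite matrix $V$ such that, under $F_{n_q}$, $\sqrt{n_q}(\hat\theta-\theta_{F_{n_q}})\to_d N(0,V)$ and $\hat V\to_p V$ as $q\to\infty$. (2) There is a set $\mathcal U\subset\mathbb R^k$ such that (a) $g$ is differentiable on $\mathcal U$ with derivative $G$, and $G$ is uniformly continuous on $\mathcal U$; (b) for every sequence $F_n\in\mathcal F_n$ there is $\epsilon>0$ such that the open ball $B(\theta_{F_n},\epsilon)$ is contained in $\mathcal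 U$ for all sufficiently large $n$; (c) $\inf_{\theta\in\mathcal U}\|e_1e_1'G(\theta)-G(\theta)\|>0$ and $\sup_{\theta\in\mathcal U}\|G(\theta)\|<\infty$. Then $$\liminf_{n\to\infty}\ \inf_{\{F\in\mathcal F_n:\ g(\theta_F)\le 0\}}P_F(e_1'\theta_F\in IICI)\ \ge\ 1-\alpha$$ (with $\inf\emptyset=+\infty$). Furthermore, if $F_n\in\mathcal F_n$ is a sequence with $\sqrt n\,g(\theta_{F_n})\to 0$, then $P_{F_n}(e_1'\theta_{F_n}\in IICI)\to 1-\alpha$ as $n\to\infty$. -/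

import Mathlib

open Filter Topology MeasureTheory ProbabilityTheory
open scoped Matrix ENNReal

namespace IneqCI

/-- The `p`-quantile of the standard normal distribution (the generalized inverse of its
distribution function). -/
noncomputable def stdNormalQuantile (p : ℝ) : ℝ :=
  sInf {x : ℝ | p ≤ cdf (gaussianReal 0 1) x}

section
variable {k : ℕ} [NeZero k]

/-- The first standard basis vector of `ℝᵏ` (the first coordinate has index `0`). -/
noncomputable def e1 : EuclideanSpace ℝ (Fin k) := EuclideanSpace.single 0 1

/-- The bilinear expression `x' V y`. -/
noncomputable def bil (V : Matrix (Fin k) (Fin k) ℝ) (x y : EuclideanSpace ℝ (Fin k)) : ℝ :=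
  x.ofLp ⬝ᵥ (V *ᵥ y.ofLp)

/-- The standard error `n^{-1/2} (e₁' V e₁)^{1/2}` of the first coordinate. -/
noncomputable def usualSE (n : ℕ) (V : Matrix (Fin k) (Fin k) ℝ) : ℝ :=
  (√(n : ℝ))⁻¹ * √(bil V e1 e1)

/-- The equality-imposed estimator `t - V a (a' V a)⁻¹ y`, where `t` is the unrestricted estimate,
`y` is the value of the constraint function at `t` and `a` is its gradient at `t`. -/
noncomputable def eqEstimator (V : Matrix (Fin k) (Fin k) ℝ) (t a : EuclideanSpace ℝ (Fin k))
    (y : ℝ) : EuclideanSpace ℝ (Fin k) :=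
  t - ((bil V a a)⁻¹ * y) • WithLp.toLp 2 (V *ᵥ a.ofLp)

/-- The standard error `n^{-1/2} (e₁' V e₁ - e₁' V a (a' V a)⁻¹ a' V e₁)^{1/2}` of the first
coordinate of the equality-imposed estimator. -/
noncomputable def eqSE (n : ℕ) (V : Matrix (Fin k) (Fin k) ℝ)
    (a : EuclideanSpace ℝ (Fin k)) : ℝ :=
  (√(n : ℝ))⁻¹ * √(bil V e1 e1 - bil V e1 a * (bil V a a)⁻¹ * bil V a e1)

open Classical in
/-- The threshold at which the interval switches between its two regimes. -/
noncomputable def threshold (α : ℝ) (n : ℕ) (V : Matrix (Fin k) (Fin k) ℝ)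
    (a : EuclideanSpace ℝ (Fin k)) : ℝ :=
  if bil V e1 a ≠ 0 then
    (bil V e1 a)⁻¹ * bil V a a * (usualSE n V - eqSE n V a) * stdNormalQuantile (1 - α / 2)
  else 0

open Classical in
/-- The lower endpoint of the inequality-imposed confidence interval. -/
noncomputable def lowerEnd (α : ℝ) (n : ℕ) (V : Matrix (Fin k) (Fin k) ℝ)
    (t a : EuclideanSpace ℝ (Fin k)) (y : ℝ) : ℝ :=
  if y ≤ threshold α n V a then
    t 0 - usualSE n V * stdNormalQuantile (1 - α / 2)
  else
    eqEstimator V t a y 0 - eqSE n V a * stdNormalQuantile (1 - α / 2)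

open Classical in
/-- The upper endpoint of the inequality-imposed confidence interval. -/
noncomputable def upperEnd (α : ℝ) (n : ℕ) (V : Matrix (Fin k) (Fin k) ℝ)
    (t a : EuclideanSpace ℝ (Fin k)) (y : ℝ) : ℝ :=
  if y ≤ -threshold α n V a then
    t 0 + usualSE n V * stdNormalQuantile (1 - α / 2)
  else
    eqEstimator V t a y 0 + eqSE n V a * stdNormalQuantile (1 - α / 2)

/-- The inequality-imposed confidence interval of nominal level `1 - α` for the first coordinate
of the parameter under the inequality `g ≤ 0`, computed from the sample size `n`, the estimate `t`
and the variance estimate `V`; `G` is the gradient of `g`. -/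
noncomputable def IICI (α : ℝ) (g : EuclideanSpace ℝ (Fin k) → ℝ)
    (G : EuclideanSpace ℝ (Fin k) → EuclideanSpace ℝ (Fin k)) (n : ℕ)
    (t : EuclideanSpace ℝ (Fin k)) (V : Matrix (Fin k) (Fin k) ℝ) : Set ℝ :=
  Set.Icc (lowerEnd α n V t (G t) (g t)) (upperEnd α n V t (G t) (g t))

/-- Asymptotic normality of the estimators and consistency of the variance estimators along
subsequences, for every sequence `F n ∈ 𝓕 n`, `n = 1, 2, …`. For each sample size `n` and each
`F`, `P n F` is the law on the sample space `Ω n`, and `θ F` is the true parameter. -/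
def AsympNormalAlongSubseq {Ω : ℕ → Type*} [∀ n, MeasurableSpace (Ω n)] {𝔽 : Type*}
    (𝓕 : ℕ → Set 𝔽) (P : (n : ℕ) → 𝔽 → Measure (Ω n)) [∀ n F, IsProbabilityMeasure (P n F)]
    (θ : 𝔽 → EuclideanSpace ℝ (Fin k))
    (θhat : (n : ℕ) → Ω n → EuclideanSpace ℝ (Fin k))
    (Vhat : (n : ℕ) → Ω n → Matrix (Fin k) (Fin k) ℝ) : Prop :=
  ∀ F : ℕ → 𝔽, (∀ n, 1 ≤ n → F n ∈ 𝓕 n) →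
    ∀ φ : ℕ → ℕ, StrictMono φ →
      ∃ ψ : ℕ → ℕ, StrictMono ψ ∧ ∃ V : Matrix (Fin k) (Fin k) ℝ, V.PosDef ∧
        TendstoInDistribution (Ω := fun q => Ω (φ (ψ q)))
          (fun q ω => √(φ (ψ q) : ℝ) • (θhat (φ (ψ q)) ω - θ (F (φ (ψ q)))))
          atTop (id : EuclideanSpace ℝ (Fin k) → EuclideanSpace ℝ (Fin k))
          (fun q => P (φ (ψ q)) (F (φ (ψ q)))) (multivariateGaussian 0 V) ∧
        ∀ i j, ∀ ε : ℝ, 0 < ε →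
          Tendsto (fun q => P (φ (ψ q)) (F (φ (ψ q)))
            {ω | ε ≤ |Vhat (φ (ψ q)) ω i j - V i j|}) atTop (𝓝 0)

end

end IneqCI

/-! Let Z be the limit of √n(θ̂ − θ_F), a the limiting gradient, σ and τ the limits of √n ŝ and √n
s̈, and b = e₁'Va/(a'Va). The scaled threshold tends to c with bc = (σ − τ)z. This identity makes
the two formulas for each endpoint agree at the switch, so coverage is, with probability tending to
one, nonnegativity of a continuous function `margin` of √n(θ̂ − θ_F)₁ and √n g(θ̂)
(`mem_interval_iff_margin`), and its probability passes to the limit (`tendsto_measure_nonneg`). By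
the delta method √n g(θ̂) behaves like a'Z + h, where h ≤ 0 is a subsequential limit of √n g(θ_F);
if it is −∞, only the usual interval matters.

In the limit X₁ = Z₁/σ and X₂ = (Z₁ − b a'Z)/τ are jointly Gaussian with unit variances, so X₁ + X₂
and X₁ − X₂ are independent. With b ≥ 0 by symmetry and δ = −bh/τ ≥ 0, noncoverage has probability
P(X₁ > z, X₂ > z − δ) + P(X₁ > z or X₂ > z + δ). At δ = 0 inclusion–exclusion gives exactly α. For δ
> 0 the first term gains no more than the second loses: this is `sumDiffLaw_strip_le`, proved by
reflection in the line x₁ + x₂ = 2z.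

Uniformity over F follows by compactness: a sequence violating the bound would have a subsequence
along which all these limits exist. -/

namespace IneqCI

/-! ### Convergence in probability, tightness and a Slutsky theorem. -/

section Whp

variable {ι : Type*} {Ω : ι → Type*} [∀ i, MeasurableSpace (Ω i)]

/-- The filter of events whose probability tends to one along `l`, for a family of probability
spaces. Convergence in probability to a constant is convergence along this filter; no
measurability is required since probabilities are outer measures. -/
def whp (P : ∀ i, Measure (Ω i)) (l : Filter ι) : Filter (Σ i, Ω i) where
  sets := {A | Tendsto (fun i => P i {ω | (⟨i, ω⟩ : Σ i, Ω i) ∉ A}) l (𝓝 0)}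
  univ_sets := by simpa using tendsto_const_nhds
  sets_of_superset := by
    intro A B hA hAB
    exact tendsto_of_tendsto_of_tendsto_of_le_of_le tendsto_const_nhds hA
      (fun _ => zero_le) fun i => measure_mono fun ω hω h => hω (hAB h)
  inter_sets := by
    intro A B hA hB
    have h := Tendsto.add (Set.mem_ofPred.1 hA) (Set.mem_ofPred.1 hB)
    rw [add_zero] at h
    refine tendsto_of_tendsto_of_tendsto_of_le_of_le tendsto_const_nhds h
      (fun _ => zero_le) fun i => (measure_mono fun ω hω => ?_).trans (measure_union_le _ _)
    by_contra hcon
    simp only [Set.mem_union, Set.mem_ofPred_eq, not_or, not_not] at hcon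
    exact hω ⟨hcon.1, hcon.2⟩

variable {P : ∀ i, Measure (Ω i)} {l : Filter ι}

lemma eventually_whp {p : (Σ i, Ω i) → Prop} :
    (∀ᶠ x in whp P l, p x) ↔ Tendsto (fun i => P i {ω | ¬ p ⟨i, ω⟩}) l (𝓝 0) := Iff.rfl

lemma eventually_whp_of_eventually {p : (Σ i, Ω i) → Prop} (h : ∀ᶠ i in l, ∀ ω, p ⟨i, ω⟩) :
    ∀ᶠ x in whp P l, p x := by
  rw [eventually_whp]
  refine tendsto_const_nhds.congr' ?_
  filter_upwards [h] with i hi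
  simp [hi]

lemma tendsto_fst_whp : Tendsto Sigma.fst (whp P l) l := fun _ hA =>
  eventually_whp_of_eventually (mem_of_superset hA fun _ hi _ => hi)

/-- Boundedness in probability. -/
def TightAlong {E : Type*} [Norm E] (P : ∀ i, Measure (Ω i)) (l : Filter ι)
    (Z : ∀ i, Ω i → E) : Prop :=
  ∀ η : ℝ≥0∞, 0 < η → ∃ M : ℝ, ∀ᶠ i in l, P i {ω | M < ‖Z i ω‖} ≤ η

/-- Permits assuming `‖Z‖ ≤ M` with `M` fixed when showing that an event has probability tending to
one; the later `O_p` arguments rest on it. -/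
lemma TightAlong.eventually_whp {E : Type*} [Norm E] {Z : ∀ i, Ω i → E} (hZ : TightAlong P l Z)
    {p : (Σ i, Ω i) → Prop} (h : ∀ M : ℝ, ∀ᶠ x in whp P l, ‖Z x.1 x.2‖ ≤ M → p x) :
    ∀ᶠ x in whp P l, p x := by
  rw [IneqCI.eventually_whp, ENNReal.tendsto_nhds_zero]
  intro ε hε
  obtain ⟨M, hM⟩ := hZ (ε / 2) (ENNReal.half_pos hε.ne')
  have h2 := ENNReal.tendsto_nhds_zero.1 (IneqCI.eventually_whp.1 (h M)) (ε / 2)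
    (ENNReal.half_pos hε.ne')
  filter_upwards [hM, h2] with i h1 h2
  calc P i {ω | ¬ p ⟨i, ω⟩}
      ≤ P i ({ω | M < ‖Z i ω‖} ∪ {ω | ¬ (‖Z i ω‖ ≤ M → p ⟨i, ω⟩)}) := by
        refine measure_mono fun ω hω => ?_
        by_cases hc : M < ‖Z i ω‖
        · exact Or.inl hc
        · exact Or.inr fun hh => hω (hh (not_lt.1 hc))
    _ ≤ ε / 2 + ε / 2 := (measure_union_le _ _).trans (add_le_add h1 h2)
    _ = ε := ENNReal.add_halves ε

lemma TightAlong.tendsto_zero_of_le_mul {E F : Type*} [Norm E] [SeminormedAddCommGroup F]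
    {Z : ∀ i, Ω i → E} (hZ : TightAlong P l Z) {R : (Σ i, Ω i) → F}
    (h : ∀ ε : ℝ, 0 < ε → ∀ᶠ x in whp P l, ‖R x‖ ≤ ε * ‖Z x.1 x.2‖) :
    Tendsto R (whp P l) (𝓝 0) := by
  rw [NormedAddGroup.tendsto_nhds_zero]
  intro ε hε
  refine hZ.eventually_whp fun M => ?_
  filter_upwards [h (ε / (2 * (|M| + 1))) (by positivity)] with x hx hM
  calc ‖R x‖ ≤ ε / (2 * (|M| + 1)) * ‖Z x.1 x.2‖ := hx
    _ ≤ ε / (2 * (|M| + 1)) * (|M| + 1) := by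
        gcongr; exact hM.trans ((le_abs_self M).trans (by linarith))
    _ = ε / 2 := by field_simp
    _ < ε := by linarith

/-- On a closed ball, compact since `E` is proper, continuity in the parameter is uniform in `z`;
tightness confines `Z` to such a ball. -/
lemma TightAlong.tendsto_sub_of_continuous {E S : Type*} [NormedAddCommGroup E] [ProperSpace E]
    [TopologicalSpace S] {Z : ∀ i, Ω i → E} (hZ : TightAlong P l Z) {Φ : E × S → ℝ}
    (hΦ : Continuous Φ) {p : (Σ i, Ω i) → S} {p₀ : S} (hp : Tendsto p (whp P l) (𝓝 p₀)) :
    Tendsto (fun x => Φ (Z x.1 x.2, p x) - Φ (Z x.1 x.2, p₀)) (whp P l) (𝓝 0) := by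
  rw [NormedAddGroup.tendsto_nhds_zero]
  intro ε hε
  refine hZ.eventually_whp fun M => ?_
  have hK : ∀ᶠ s in 𝓝 p₀, ∀ z ∈ Metric.closedBall (0 : E) M, ‖Φ (z, s) - Φ (z, p₀)‖ < ε := by
    refine (isCompact_closedBall (0 : E) M).eventually_forall_of_forall_eventually fun z _ => ?_
    have hc : Continuous fun q : S × E => ‖Φ (q.2, q.1) - Φ (q.2, p₀)‖ := by fun_prop
    have := hc.tendsto (p₀, z)
    simp only [sub_self, norm_zero] at this
    exact this.eventually (gt_mem_nhds hε)
  filter_upwards [hp.eventually hK] with x hx hM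
  exact hx _ (by simpa using hM)

/-- The closed sets `n ≤ ‖z‖` decrease to the empty set, so one has small limit mass; the
portmanteau theorem transfers this to the sequence. -/
lemma tightAlong_of_tendstoInDistribution [∀ i, IsProbabilityMeasure (P i)] {E Ω' : Type*}
    [NormedAddCommGroup E] [MeasurableSpace E] [BorelSpace E] [MeasurableSpace Ω']
    {μ' : Measure Ω'} [IsProbabilityMeasure μ'] {Z : ∀ i, Ω i → E} {Z' : Ω' → E}
    (h : TendstoInDistribution Z l Z' P μ') : TightAlong P l Z := by
  intro η hη
  set ν : Measure E := μ'.map Z' with hν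
  have : IsProbabilityMeasure ν := Measure.isProbabilityMeasure_map h.aemeasurable_limit
  have hanti : Antitone fun n : ℕ => {z : E | (n : ℝ) ≤ ‖z‖} := fun m n hmn z hz =>
    le_trans (Nat.cast_le.2 hmn) (Set.mem_ofPred.1 hz)
  have hcl : ∀ n : ℕ, IsClosed {z : E | (n : ℝ) ≤ ‖z‖} := fun n =>
    isClosed_le continuous_const continuous_norm
  have hlim := tendsto_measure_iInter_atTop (μ := ν)
    (fun n => (hcl n).measurableSet.nullMeasurableSet) hanti ⟨0, measure_ne_top _ _⟩
  have hempty : ⋂ n : ℕ, {z : E | (n : ℝ) ≤ ‖z‖} = ∅ := by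
    ext z
    simp only [Set.mem_iInter, Set.mem_ofPred_eq, Set.mem_empty_iff_false, iff_false, not_forall,
      not_le]
    exact exists_nat_gt ‖z‖
  rw [hempty, measure_empty] at hlim
  obtain ⟨n, hn⟩ := (hlim.eventually (gt_mem_nhds hη)).exists
  refine ⟨n, ?_⟩
  have hsup := (ProbabilityMeasure.limsup_measure_closed_le_of_tendsto h.tendsto (hcl n)).trans_lt hn
  filter_upwards [eventually_lt_of_limsup_lt hsup] with i hi
  refine le_trans ?_ hi.le
  simp only [ProbabilityMeasure.coe_mk]
  rw [Measure.map_apply_of_aemeasurable (h.forall_aemeasurable i) (hcl n).measurableSet]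
  exact measure_mono fun ω hω => le_of_lt (Set.mem_ofPred.1 hω)

/-- If `Z i` converges in distribution, `F` is asymptotically equivalent to `f (Z i)` and the limit
of `f (Z i)` has no atom at zero, then the probability of `0 ≤ F` converges. -/
lemma tendsto_measure_nonneg_of_tendsto_sub [∀ i, IsProbabilityMeasure (P i)] {E Ω' : Type*}
    [NormedAddCommGroup E] [MeasurableSpace E] [BorelSpace E] [MeasurableSpace Ω']
    {μ' : Measure Ω'} [IsProbabilityMeasure μ'] {Z : ∀ i, Ω i → E} {Z' : Ω' → E}
    (h : TendstoInDistribution Z l Z' P μ') {f : E → ℝ} (hf : Continuous f)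
    (hnull : μ'.map Z' {z | f z = 0} = 0) {F : (Σ i, Ω i) → ℝ}
    (hF : Tendsto (fun x => F x - f (Z x.1 x.2)) (whp P l) (𝓝 0)) :
    Tendsto (fun i => P i {ω | 0 ≤ F ⟨i, ω⟩}) l (𝓝 (μ'.map Z' {z | 0 ≤ f z})) := by
  set ν : Measure E := μ'.map Z' with hν
  have : IsProbabilityMeasure ν := Measure.isProbabilityMeasure_map h.aemeasurable_limit
  -- Off this vanishing event, `ε < f` implies `0 ≤ F`, which implies `-ε ≤ f`; the outer sets are
  -- open and closed, as the portmanteau theorem requires.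
  have hbad : ∀ ε : ℝ, 0 < ε →
      Tendsto (fun i => P i {ω | ¬ ‖F ⟨i, ω⟩ - f (Z i ω)‖ < ε}) l (𝓝 0) := fun ε hε =>
    eventually_whp.1 (NormedAddGroup.tendsto_nhds_zero.1 hF ε hε)
  have hup : ∀ ε : ℝ, 0 < ε →
      limsup (fun i => P i {ω | 0 ≤ F ⟨i, ω⟩}) l ≤ ν {z | -ε ≤ f z} := by
    intro ε hε
    have hcl : IsClosed {z : E | -ε ≤ f z} := isClosed_le continuous_const hf
    have h1 : limsup (fun i => (P i).map (Z i) {z | -ε ≤ f z}) l ≤ ν {z | -ε ≤ f z} :=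
      ProbabilityMeasure.limsup_measure_closed_le_of_tendsto h.tendsto hcl
    refine le_trans ?_ h1
    rw [← ENNReal.limsup_add_of_right_tendsto_zero (hbad ε hε)
      (fun i => (P i).map (Z i) {z | -ε ≤ f z})]
    refine limsup_le_limsup (Eventually.of_forall fun i => ?_)
    simp only [Pi.add_apply]
    rw [Measure.map_apply_of_aemeasurable (h.forall_aemeasurable i) hcl.measurableSet]
    refine (measure_mono fun ω hω => ?_).trans (measure_union_le _ _)
    by_cases hc : ‖F ⟨i, ω⟩ - f (Z i ω)‖ < ε
    · left
      have hω' : 0 ≤ F ⟨i, ω⟩ := hω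
      have := (abs_lt.1 hc).2
      simp only [Set.mem_preimage, Set.mem_ofPred_eq]
      linarith
    · exact Or.inr hc
  have hlow : ∀ ε : ℝ, 0 < ε →
      ν {z | ε < f z} ≤ liminf (fun i => P i {ω | 0 ≤ F ⟨i, ω⟩}) l := by
    intro ε hε
    have hop : IsOpen {z : E | ε < f z} := isOpen_lt continuous_const hf
    have h1 := ProbabilityMeasure.le_liminf_measure_open_of_tendsto h.tendsto hop
    refine le_trans h1 ?_
    rw [← ENNReal.liminf_add_of_right_tendsto_zero (hbad ε hε)
      (fun i => P i {ω | 0 ≤ F ⟨i, ω⟩})]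
    refine liminf_le_liminf (Eventually.of_forall fun i => ?_)
    simp only [ProbabilityMeasure.coe_mk, Pi.add_apply]
    rw [Measure.map_apply_of_aemeasurable (h.forall_aemeasurable i) hop.measurableSet]
    refine (measure_mono fun ω hω => ?_).trans (measure_union_le _ _)
    by_cases hc : ‖F ⟨i, ω⟩ - f (Z i ω)‖ < ε
    · left
      have hω' : ε < f (Z i ω) := hω
      have := (abs_lt.1 hc).1
      simp only [Set.mem_ofPred_eq]
      linarith
    · exact Or.inr hc
  -- Now ε = 1/(n+1) → 0: the two bounds become the masses of `0 < f` and `0 ≤ f`, which agree by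
  -- `hnull`.
  have hpos : ∀ n : ℕ, (0 : ℝ) < 1 / ((n : ℝ) + 1) := fun n => by positivity
  refine tendsto_of_le_liminf_of_limsup_le ?_ ?_
  · have heq : ν {z | 0 ≤ f z} ≤ ν {z | 0 < f z} := by
      calc ν {z | 0 ≤ f z} ≤ ν ({z | 0 < f z} ∪ {z | f z = 0}) := by
            refine measure_mono fun z hz => ?_
            rcases (Set.mem_ofPred.1 hz).lt_or_eq with h | h
            · exact Or.inl h
            · exact Or.inr h.symm
        _ ≤ ν {z | 0 < f z} := by
            refine (measure_union_le _ _).trans ?_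
            rw [hnull, add_zero]
    refine heq.trans ?_
    have hU : {z | 0 < f z} = ⋃ n : ℕ, {z | 1 / ((n : ℝ) + 1) < f z} := by
      ext z
      simp only [Set.mem_ofPred_eq, Set.mem_iUnion]
      exact ⟨fun hz => exists_nat_one_div_lt hz, fun ⟨n, hn⟩ => (hpos n).trans hn⟩
    have hmono : Monotone fun n : ℕ => {z | 1 / ((n : ℝ) + 1) < f z} := fun m n hmn z hz =>
      lt_of_le_of_lt (Nat.one_div_le_one_div hmn) (Set.mem_ofPred.1 hz)
    rw [hU, hmono.measure_iUnion]
    exact iSup_le fun n => hlow _ (hpos n)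
  · have hanti : Antitone fun n : ℕ => {z | -(1 / ((n : ℝ) + 1)) ≤ f z} := fun m n hmn z hz =>
      le_trans (neg_le_neg (Nat.one_div_le_one_div hmn)) (Set.mem_ofPred.1 hz)
    have hlim := tendsto_measure_iInter_atTop (μ := ν)
      (fun n : ℕ => (isClosed_le (f := fun _ => -(1 / ((n : ℝ) + 1)))
        continuous_const hf).measurableSet.nullMeasurableSet) hanti ⟨0, measure_ne_top _ _⟩
    have hI : ⋂ n : ℕ, {z | -(1 / ((n : ℝ) + 1)) ≤ f z} = {z | 0 ≤ f z} := by
      ext z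
      simp only [Set.mem_iInter, Set.mem_ofPred_eq]
      refine ⟨fun hz => ?_, fun hz n => (neg_nonpos.2 (hpos n).le).trans hz⟩
      by_contra hneg
      obtain ⟨n, hn⟩ := exists_nat_one_div_lt (neg_pos.2 (not_le.1 hneg))
      linarith [hz n]
    rw [hI] at hlim
    exact ge_of_tendsto' hlim fun n => hup _ (hpos n)

/-- A continuous function of a sequence converging in distribution and of estimators converging in
probability to a constant: the probability that it is nonnegative converges. -/
lemma tendsto_measure_nonneg [∀ i, IsProbabilityMeasure (P i)] {E S Ω' : Type*}
    [NormedAddCommGroup E] [ProperSpace E] [MeasurableSpace E] [BorelSpace E] [MeasurableSpace Ω']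
    [TopologicalSpace S] {μ' : Measure Ω'} [IsProbabilityMeasure μ'] {Z : ∀ i, Ω i → E}
    {Z' : Ω' → E} (h : TendstoInDistribution Z l Z' P μ') {Φ : E × S → ℝ} (hΦ : Continuous Φ)
    {p : (Σ i, Ω i) → S} {p₀ : S} (hp : Tendsto p (whp P l) (𝓝 p₀))
    (hnull : μ'.map Z' {z | Φ (z, p₀) = 0} = 0) {A : ∀ i, Set (Ω i)}
    (hA : ∀ᶠ x in whp P l, x.2 ∈ A x.1 ↔ 0 ≤ Φ (Z x.1 x.2, p x)) :
    Tendsto (fun i => P i (A i)) l (𝓝 (μ'.map Z' {z | 0 ≤ Φ (z, p₀)})) := by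
  classical
  have hT := tightAlong_of_tendstoInDistribution h
  have hf : Continuous fun z => Φ (z, p₀) := by fun_prop
  -- Where the equivalence fails, the function is reset to 0 or −1 according to membership in `A`,
  -- so that its nonnegativity describes `A i` exactly.
  have key := tendsto_measure_nonneg_of_tendsto_sub h hf hnull
    (F := fun x => if x.2 ∈ A x.1 ↔ 0 ≤ Φ (Z x.1 x.2, p x) then Φ (Z x.1 x.2, p x)
      else if x.2 ∈ A x.1 then 0 else -1) ?_
  · refine key.congr fun i => ?_
    congr 1
    ext ω
    simp only [Set.mem_ofPred_eq]
    by_cases h1 : ω ∈ A i ↔ 0 ≤ Φ (Z i ω, p ⟨i, ω⟩)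
    · simp only [h1, if_true]
    · rw [if_neg h1]
      by_cases h2 : ω ∈ A i
      · simp [h2]
      · simp [h2]
  · refine (hT.tendsto_sub_of_continuous hΦ hp).congr' ?_
    filter_upwards [hA] with x hx
    rw [if_pos hx]

end Whp

/-! ### The Gaussian inequality for the acceptance region. -/

section GaussianCore

open scoped NNReal

/-- Reflection about `c ≥ 0` moves a point of `[c, ∞)` to one no farther from 0, where the density
is at least as large. The zero-variance law has no density and is treated apart. -/
lemma gaussianReal_le_preimage_reflection (v : ℝ≥0) {c : ℝ} (hc : 0 ≤ c) {A : Set ℝ}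
    (hA : MeasurableSet A) (hAc : A ⊆ Set.Ici c) :
    gaussianReal 0 v A ≤ gaussianReal 0 v ((fun u => 2 * c - u) ⁻¹' A) := by
  have hm : Measurable fun u : ℝ => 2 * c - u := by fun_prop
  rw [← Measure.map_apply hm hA, gaussianReal_map_const_sub, sub_zero]
  by_cases hv : v = 0
  · subst hv
    rw [gaussianReal_zero_var, gaussianReal_zero_var, Measure.dirac_apply' _ hA,
      Measure.dirac_apply' _ hA]
    by_cases h0 : (0 : ℝ) ∈ A
    · have hc0 : c = 0 := le_antisymm (hAc h0) hc
      simp [hc0]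
    · simp [h0]
  · rw [gaussianReal_apply _ hv, gaussianReal_apply _ hv]
    refine setLIntegral_mono' hA fun x hx => ?_
    have hx' : c ≤ x := hAc hx
    rw [gaussianPDF, gaussianPDF]
    refine ENNReal.ofReal_le_ofReal ?_
    rw [gaussianPDFReal, gaussianPDFReal]
    have : (x - 2 * c) ^ 2 ≤ (x - 0) ^ 2 := by nlinarith
    gcongr

/-- The joint law of `(X₁, X₂)` when `X₁ + X₂` and `X₁ - X₂` are independent centred Gaussian
variables with variances `p` and `q`. -/
noncomputable def sumDiffLaw (p q : ℝ≥0) : Measure (ℝ × ℝ) :=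
  ((gaussianReal 0 p).prod (gaussianReal 0 q)).map fun w => ((w.1 + w.2) / 2, (w.1 - w.2) / 2)

instance (p q : ℝ≥0) : IsProbabilityMeasure (sumDiffLaw p q) :=
  Measure.isProbabilityMeasure_map (by fun_prop)

lemma gaussianReal_map_neg_zero (v : ℝ≥0) :
    (gaussianReal 0 v).map (fun x => -x) = gaussianReal 0 v := by
  rw [gaussianReal_map_neg, neg_zero]

lemma sumDiffLaw_map_neg (p q : ℝ≥0) :
    (sumDiffLaw p q).map (fun x => (-x.1, -x.2)) = sumDiffLaw p q := by
  conv_rhs => rw [sumDiffLaw, ← gaussianReal_map_neg_zero p, ← gaussianReal_map_neg_zero q,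
    Measure.map_prod_map _ _ (by fun_prop) (by fun_prop), Measure.map_map (by fun_prop) (by fun_prop)]
  rw [sumDiffLaw, Measure.map_map (by fun_prop) (by fun_prop)]
  congr 1
  ext w <;> simp <;> ring

lemma sumDiffLaw_map_swap (p q : ℝ≥0) :
    (sumDiffLaw p q).map Prod.swap = sumDiffLaw p q := by
  conv_rhs => rw [sumDiffLaw, ← gaussianReal_map_neg_zero q, ← (gaussianReal 0 p).map_id,
    Measure.map_prod_map _ _ (by fun_prop) (by fun_prop), Measure.map_map (by fun_prop) (by fun_prop)]
  rw [sumDiffLaw, Measure.map_map (by fun_prop) (by fun_prop)]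
  congr 1
  ext w <;> simp
  ring

/-- Reflection in the line x₁ + x₂ = 2z fixes the difference and sends the sum u to 4z − u.
Conditionally on the difference it is therefore the one-dimensional reflection about 2z. -/
lemma sumDiffLaw_le_preimage_reflection (p q : ℝ≥0) {z : ℝ} (hz : 0 ≤ z) {S : Set (ℝ × ℝ)}
    (hS : MeasurableSet S) (hSz : ∀ x ∈ S, 2 * z ≤ x.1 + x.2) :
    sumDiffLaw p q S ≤ sumDiffLaw p q ((fun x => (2 * z - x.2, 2 * z - x.1)) ⁻¹' S) := by
  have hm : Measurable fun w : ℝ × ℝ => ((w.1 + w.2) / 2, (w.1 - w.2) / 2) := by fun_prop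
  have hρ : Measurable fun x : ℝ × ℝ => (2 * z - x.2, 2 * z - x.1) := by fun_prop
  rw [sumDiffLaw, Measure.map_apply hm hS, Measure.map_apply hm (hρ hS),
    Measure.prod_apply_symm (hm hS), Measure.prod_apply_symm (hm (hρ hS))]
  refine lintegral_mono fun y => ?_
  have h1 : MeasurableSet ((fun x : ℝ => (x, y)) ⁻¹'
      ((fun w : ℝ × ℝ => ((w.1 + w.2) / 2, (w.1 - w.2) / 2)) ⁻¹' S)) :=
    (measurable_prodMk_right (hm hS))
  refine (gaussianReal_le_preimage_reflection p (c := 2 * z) (by positivity) h1 ?_).trans_eq ?_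
  · intro u hu
    have := hSz _ hu
    simp only at this
    simp only [Set.mem_Ici]
    linarith
  · congr 1
    ext u
    simp only [Set.mem_preimage]
    have e1 : (2 * (2 * z) - u + y) / 2 = 2 * z - (u - y) / 2 := by ring
    have e2 : (2 * (2 * z) - u - y) / 2 = 2 * z - (u + y) / 2 := by ring
    rw [e1, e2]

/-- The probability transferred by shifting one of the two faces of the acceptance region. -/
lemma sumDiffLaw_strip_le (p q : ℝ≥0) {z δ : ℝ} (hz : 0 ≤ z) :
    sumDiffLaw p q {x | z < x.1 ∧ z - δ < x.2 ∧ x.2 < z} ≤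
      sumDiffLaw p q {x | x.1 ≤ z ∧ z ≤ x.2 ∧ x.2 ≤ z + δ} := by
  set κ := sumDiffLaw p q with hκ
  have hsw : κ {x | x.1 ≤ z ∧ z ≤ x.2 ∧ x.2 ≤ z + δ} =
      κ {x | x.2 ≤ z ∧ z ≤ x.1 ∧ x.1 ≤ z + δ} := by
    have hmeas : MeasurableSet {x : ℝ × ℝ | x.1 ≤ z ∧ z ≤ x.2 ∧ x.2 ≤ z + δ} := by measurability
    conv_lhs => rw [hκ, ← sumDiffLaw_map_swap, Measure.map_apply measurable_swap hmeas]
    rfl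
  have hm2 : MeasurableSet {x : ℝ × ℝ | z + δ < x.1 ∧ z - δ < x.2 ∧ x.2 < z} := by measurability
  have hm3 : MeasurableSet {x : ℝ × ℝ | x.2 ≤ z - δ ∧ z ≤ x.1 ∧ x.1 ≤ z + δ} := by measurability
  -- The part with `x.1 ≤ z + δ` already lies in the swapped target strip. The rest reflects into
  -- the portion `x.2 ≤ z - δ` of that strip, disjoint from the first part.
  have hrefl : κ {x | z + δ < x.1 ∧ z - δ < x.2 ∧ x.2 < z} ≤
      κ {x | x.2 ≤ z - δ ∧ z ≤ x.1 ∧ x.1 ≤ z + δ} := by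
    refine (sumDiffLaw_le_preimage_reflection p q hz hm2 ?_).trans (measure_mono ?_)
    · rintro x ⟨h1, h2, -⟩
      linarith
    · rintro x ⟨h1, h2, h3⟩
      simp only at h1 h2 h3
      exact ⟨by linarith, by linarith, by linarith⟩
  rw [hsw]
  calc κ {x | z < x.1 ∧ z - δ < x.2 ∧ x.2 < z}
      ≤ κ ({x | (z < x.1 ∧ x.1 ≤ z + δ) ∧ z - δ < x.2 ∧ x.2 < z} ∪
          {x | z + δ < x.1 ∧ z - δ < x.2 ∧ x.2 < z}) := by
        refine measure_mono fun x hx => ?_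
        rcases le_or_gt x.1 (z + δ) with h | h
        · exact Or.inl ⟨⟨hx.1, h⟩, hx.2⟩
        · exact Or.inr ⟨h, hx.2⟩
    _ ≤ κ {x | (z < x.1 ∧ x.1 ≤ z + δ) ∧ z - δ < x.2 ∧ x.2 < z} +
          κ {x | x.2 ≤ z - δ ∧ z ≤ x.1 ∧ x.1 ≤ z + δ} :=
        (measure_union_le _ _).trans (by gcongr)
    _ = κ ({x | (z < x.1 ∧ x.1 ≤ z + δ) ∧ z - δ < x.2 ∧ x.2 < z} ∪
          {x | x.2 ≤ z - δ ∧ z ≤ x.1 ∧ x.1 ≤ z + δ}) := by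
        refine (measure_union ?_ hm3).symm
        rw [Set.disjoint_left]
        rintro x ⟨-, h1, -⟩ ⟨h2, -⟩
        linarith
    _ ≤ _ := by
        refine measure_mono ?_
        rintro x (⟨⟨h1, h2⟩, h3, h4⟩ | ⟨h1, h2, h3⟩)
        · exact ⟨h4.le, h1.le, h2⟩
        · refine ⟨?_, h2, h3⟩
          linarith

/-- The acceptance region of the interval, in standardized coordinates. -/
def acceptRegion (z δ : ℝ) : Set (ℝ × ℝ) :=
  {x | (x.1 ≤ z ∨ x.2 ≤ z - δ) ∧ -x.1 ≤ z ∧ -x.2 ≤ z + δ}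

lemma measurableSet_acceptRegion (z δ : ℝ) : MeasurableSet (acceptRegion z δ) := by
  unfold acceptRegion; measurability

lemma acceptRegion_compl (z δ : ℝ) : (acceptRegion z δ)ᶜ =
    {x | z < x.1 ∧ z - δ < x.2} ∪ (fun x : ℝ × ℝ => (-x.1, -x.2)) ⁻¹' {x | z < x.1 ∨ z + δ < x.2} := by
  ext x
  simp only [acceptRegion, Set.mem_compl_iff, Set.mem_ofPred_eq, Set.mem_union, Set.mem_preimage,
    not_and_or, not_or, not_le]

lemma sumDiffLaw_preimage_neg (p q : ℝ≥0) {S : Set (ℝ × ℝ)} (hS : MeasurableSet S) :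
    sumDiffLaw p q ((fun x : ℝ × ℝ => (-x.1, -x.2)) ⁻¹' S) = sumDiffLaw p q S := by
  rw [← Measure.map_apply (by fun_prop) hS, sumDiffLaw_map_neg]

lemma gaussianReal_Ici {v : ℝ≥0} (hv : v ≠ 0) (m z : ℝ) :
    gaussianReal m v (Set.Ici z) = gaussianReal m v (Set.Ioi z) := by
  have := nullSingletonClass_gaussianReal (μ := m) hv
  exact measure_congr Ioi_ae_eq_Ici.symm

/-- After the strip inequality, the complement is bounded by the mass of `z < x.1` plus that of
three disjoint pieces of `z ≤ x.2`, that is, by α/2 + α/2. -/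
lemma le_sumDiffLaw_acceptRegion {p q : ℝ≥0} (h1 : (sumDiffLaw p q).map Prod.fst = gaussianReal 0 1)
    (h2 : (sumDiffLaw p q).map Prod.snd = gaussianReal 0 1) {z δ α : ℝ} (hα : 0 ≤ α) (hz : 0 ≤ z)
    (hzα : gaussianReal 0 1 (Set.Ioi z) = ENNReal.ofReal (α / 2)) (hδ : 0 ≤ δ) :
    ENNReal.ofReal (1 - α) ≤ sumDiffLaw p q (acceptRegion z δ) := by
  set κ := sumDiffLaw p q with hκ
  have hf : κ {x | z < x.1} = ENNReal.ofReal (α / 2) := by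
    rw [← hzα, ← h1, Measure.map_apply measurable_fst measurableSet_Ioi]; rfl
  have hs : κ {x | z ≤ x.2} = ENNReal.ofReal (α / 2) := by
    rw [← hzα, ← gaussianReal_Ici one_ne_zero, ← h2,
      Measure.map_apply measurable_snd measurableSet_Ici]; rfl
  have hup : κ {x | z < x.1 ∧ z - δ < x.2} ≤
      κ {x | z < x.1 ∧ z ≤ x.2} + κ {x | x.1 ≤ z ∧ z ≤ x.2 ∧ x.2 ≤ z + δ} := by
    refine le_trans ?_ (add_le_add_right (sumDiffLaw_strip_le p q (δ := δ) hz) _)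
    refine le_trans (measure_mono fun x hx => ?_) (measure_union_le _ _)
    rcases le_or_gt z x.2 with h | h
    · exact Or.inl ⟨hx.1, h⟩
    · exact Or.inr ⟨hx.1, hx.2, h⟩
  have hlow : κ {x | z < x.1 ∨ z + δ < x.2} ≤
      κ {x | z < x.1} + κ {x | x.1 ≤ z ∧ z + δ < x.2} := by
    refine le_trans (measure_mono fun x hx => ?_) (measure_union_le _ _)
    rcases le_or_gt x.1 z with h | h
    · exact Or.inr ⟨h, hx.resolve_left h.not_gt⟩
    · exact Or.inl h
  have htri : κ {x | z < x.1 ∧ z ≤ x.2} + κ {x | x.1 ≤ z ∧ z ≤ x.2 ∧ x.2 ≤ z + δ} +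
      κ {x | x.1 ≤ z ∧ z + δ < x.2} ≤ κ {x | z ≤ x.2} := by
    have m2 : MeasurableSet {x : ℝ × ℝ | x.1 ≤ z ∧ z ≤ x.2 ∧ x.2 ≤ z + δ} := by measurability
    have m3 : MeasurableSet {x : ℝ × ℝ | x.1 ≤ z ∧ z + δ < x.2} := by measurability
    rw [← measure_union _ m2, ← measure_union _ m3]
    · refine measure_mono ?_
      rintro x ((⟨-, h⟩ | ⟨-, h, -⟩) | ⟨-, h⟩)
      · exact h
      · exact h
      · exact Set.mem_ofPred.2 (by linarith)
    · rw [Set.disjoint_left]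
      rintro x (⟨h, -⟩ | ⟨-, -, h⟩) ⟨h', h''⟩
      · linarith
      · linarith
    · rw [Set.disjoint_left]
      rintro x ⟨h, -⟩ ⟨h', -⟩
      linarith
  have mlow : MeasurableSet {x : ℝ × ℝ | z < x.1 ∨ z + δ < x.2} := by measurability
  have hcompl : κ (acceptRegion z δ)ᶜ ≤ ENNReal.ofReal α := by
    rw [acceptRegion_compl]
    refine (measure_union_le _ _).trans ?_
    rw [hκ, sumDiffLaw_preimage_neg p q mlow, ← hκ]
    calc _ ≤ (κ {x | z < x.1 ∧ z ≤ x.2} + κ {x | x.1 ≤ z ∧ z ≤ x.2 ∧ x.2 ≤ z + δ}) +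
          (κ {x | z < x.1} + κ {x | x.1 ≤ z ∧ z + δ < x.2}) := add_le_add hup hlow
      _ = (κ {x | z < x.1 ∧ z ≤ x.2} + κ {x | x.1 ≤ z ∧ z ≤ x.2 ∧ x.2 ≤ z + δ} +
          κ {x | x.1 ≤ z ∧ z + δ < x.2}) + κ {x | z < x.1} := by ring
      _ ≤ ENNReal.ofReal (α / 2) + ENNReal.ofReal (α / 2) := by
          rw [hf]; exact add_le_add_left (htri.trans_eq hs) _
      _ = ENNReal.ofReal α := by
          rw [← ENNReal.ofReal_add (by positivity) (by positivity), add_halves]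
  rw [← compl_compl (acceptRegion z δ), prob_compl_eq_one_sub (measurableSet_acceptRegion z δ).compl,
    ENNReal.ofReal_sub _ hα, ENNReal.ofReal_one]
  exact tsub_le_tsub_left hcompl 1

/-- At δ = 0 the complement splits, up to a sign change, into the intersection and the union of `z <
x.1` and `z < x.2`; these two masses sum to α/2 + α/2. -/
lemma sumDiffLaw_acceptRegion_zero {p q : ℝ≥0}
    (h1 : (sumDiffLaw p q).map Prod.fst = gaussianReal 0 1)
    (h2 : (sumDiffLaw p q).map Prod.snd = gaussianReal 0 1) {z α : ℝ} (hα : 0 ≤ α) (hz : 0 ≤ z)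
    (hzα : gaussianReal 0 1 (Set.Ioi z) = ENNReal.ofReal (α / 2)) :
    sumDiffLaw p q (acceptRegion z 0) = ENNReal.ofReal (1 - α) := by
  set κ := sumDiffLaw p q with hκ
  have hf : κ {x | z < x.1} = ENNReal.ofReal (α / 2) := by
    rw [← hzα, ← h1, Measure.map_apply measurable_fst measurableSet_Ioi]; rfl
  have hs : κ {x | z < x.2} = ENNReal.ofReal (α / 2) := by
    rw [← hzα, ← h2, Measure.map_apply measurable_snd measurableSet_Ioi]; rfl
  have mlow : MeasurableSet {x : ℝ × ℝ | z < x.1 ∨ z + 0 < x.2} := by measurability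
  have ms : MeasurableSet {x : ℝ × ℝ | z < x.2} := by measurability
  have hcompl : κ (acceptRegion z 0)ᶜ = ENNReal.ofReal α := by
    rw [acceptRegion_compl, measure_union _ (mlow.preimage (by fun_prop)), hκ,
      sumDiffLaw_preimage_neg p q mlow, ← hκ, sub_zero, add_zero]
    · have := measure_union_add_inter (μ := κ) {x : ℝ × ℝ | z < x.1} ms
      rw [hf, hs, ← ENNReal.ofReal_add (by positivity) (by positivity), add_halves] at this
      rw [← this, add_comm]
      rfl
    · rw [Set.disjoint_left]
      rintro x ⟨h, h'⟩ (h'' | h'')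
      · simp only at h''; linarith
      · simp only at h''; linarith
  rw [← compl_compl (acceptRegion z 0), prob_compl_eq_one_sub (measurableSet_acceptRegion z 0).compl,
    ENNReal.ofReal_sub _ hα, ENNReal.ofReal_one, hcompl]

lemma gaussianReal_abs_le {z α : ℝ} (hα : 0 ≤ α) (hz : 0 ≤ z)
    (hzα : gaussianReal 0 1 (Set.Ioi z) = ENNReal.ofReal (α / 2)) :
    gaussianReal 0 1 {x | |x| ≤ z} = ENNReal.ofReal (1 - α) := by
  have hc : {x : ℝ | |x| ≤ z}ᶜ = Set.Ioi z ∪ (fun x => -x) ⁻¹' Set.Ioi z := by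
    ext x
    simp only [Set.mem_compl_iff, Set.mem_ofPred_eq, not_le, Set.mem_union, Set.mem_Ioi,
      Set.mem_preimage, lt_abs]
  have hm : MeasurableSet {x : ℝ | |x| ≤ z} := measurableSet_le (by fun_prop) (by fun_prop)
  have hcompl : gaussianReal 0 1 {x : ℝ | |x| ≤ z}ᶜ = ENNReal.ofReal α := by
    rw [hc, measure_union _ (measurableSet_Ioi.preimage (by fun_prop)),
      ← Measure.map_apply (by fun_prop) measurableSet_Ioi, gaussianReal_map_neg_zero, hzα,
      ← ENNReal.ofReal_add (by positivity) (by positivity), add_halves]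
    rw [Set.disjoint_left]
    intro x h h'
    simp only [Set.mem_Ioi, Set.mem_preimage] at h h'
    linarith
  rw [← compl_compl {x : ℝ | |x| ≤ z}, prob_compl_eq_one_sub hm.compl,
    ENNReal.ofReal_sub _ hα, ENNReal.ofReal_one, hcompl]

end GaussianCore

/-! ### The standard normal quantile. -/

section Quantile

lemma continuous_cdf_gaussianReal : Continuous (cdf (gaussianReal 0 1)) := by
  have := nullSingletonClass_gaussianReal (μ := 0) one_ne_zero
  rw [continuous_iff_continuousAt]
  intro x
  have h := StieltjesFunction.measure_singleton (cdf (gaussianReal 0 1)) x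
  rw [measure_cdf, measure_singleton, eq_comm, ENNReal.ofReal_eq_zero, sub_nonpos] at h
  have hle := (monotone_cdf (gaussianReal 0 1)).leftLim_le (le_refl x)
  rw [(monotone_cdf (gaussianReal 0 1)).continuousAt_iff_leftLim_eq_rightLim,
    StieltjesFunction.rightLim_eq]
  exact le_antisymm hle h

lemma cdf_gaussianReal_zero : cdf (gaussianReal 0 1) 0 = 1 / 2 := by
  have hneg : gaussianReal 0 1 (Set.Iic 0) = gaussianReal 0 1 (Set.Ioi 0) := by
    rw [← gaussianReal_Ici one_ne_zero]
    conv_lhs => rw [← gaussianReal_map_neg_zero, Measure.map_apply (by fun_prop) measurableSet_Iic]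
    congr 1
    ext x
    simp
  have h := measureReal_compl (μ := gaussianReal 0 1) (measurableSet_Iic (a := (0 : ℝ)))
  rw [Set.compl_Iic, probReal_univ, measureReal_def, ← hneg, ← measureReal_def] at h
  rw [cdf_eq_real]
  linarith

lemma cdf_stdNormalQuantile {p : ℝ} (h0 : 0 < p) (h1 : p < 1) :
    cdf (gaussianReal 0 1) (stdNormalQuantile p) = p := by
  set F := cdf (gaussianReal 0 1)
  have hc : Continuous F := continuous_cdf_gaussianReal
  obtain ⟨a, ha⟩ := ((tendsto_cdf_atBot (gaussianReal 0 1)).eventually (gt_mem_nhds h0)).exists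
  obtain ⟨b, hb⟩ := ((tendsto_cdf_atTop (gaussianReal 0 1)).eventually (lt_mem_nhds h1)).exists
  have hbdd : BddBelow {x : ℝ | p ≤ F x} := by
    refine ⟨a, fun x hx => ?_⟩
    by_contra hlt
    exact absurd ((monotone_cdf (gaussianReal 0 1)) (not_le.1 hlt).le)
      (not_le.2 (ha.trans_le hx))
  have hcl : IsClosed {x : ℝ | p ≤ F x} := isClosed_le continuous_const hc
  obtain ⟨c, hcp⟩ : ∃ c, F c = p := mem_range_of_exists_le_of_exists_ge hc ⟨a, ha.le⟩ ⟨b, hb.le⟩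
  have hmem := hcl.csInf_mem ⟨b, hb.le⟩ hbdd
  refine le_antisymm ?_ hmem
  exact (monotone_cdf _ (csInf_le hbdd (Set.mem_ofPred.2 hcp.ge))).trans hcp.le

lemma stdNormalQuantile_nonneg {p : ℝ} (hp : 1 / 2 < p) : 0 ≤ stdNormalQuantile p := by
  refine Real.sInf_nonneg fun x hx => ?_
  by_contra hlt
  have := monotone_cdf (gaussianReal 0 1) (not_le.1 hlt).le
  rw [cdf_gaussianReal_zero] at this
  exact absurd (hp.trans_le hx) (not_lt.2 this)

lemma gaussianReal_Ioi_stdNormalQuantile {α : ℝ} (h0 : 0 < α) (h1 : α < 1) :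
    gaussianReal 0 1 (Set.Ioi (stdNormalQuantile (1 - α / 2))) = ENNReal.ofReal (α / 2) := by
  have h := cdf_stdNormalQuantile (p := 1 - α / 2) (by linarith) (by linarith)
  rw [← Set.compl_Iic, prob_compl_eq_one_sub measurableSet_Iic, ← ofReal_cdf, h,
    ← ENNReal.ofReal_one, ← ENNReal.ofReal_sub _ (by linarith)]
  congr 1
  ring

end Quantile

/-! ### Algebra of the interval and its scaled margin. -/

section Bil

variable {k : ℕ}

lemma bil_add_left (V : Matrix (Fin k) (Fin k) ℝ) (x x' y : EuclideanSpace ℝ (Fin k)) :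
    bil V (x + x') y = bil V x y + bil V x' y := by
  simp [bil, add_dotProduct]

lemma bil_sub_left (V : Matrix (Fin k) (Fin k) ℝ) (x x' y : EuclideanSpace ℝ (Fin k)) :
    bil V (x - x') y = bil V x y - bil V x' y := by
  simp [bil, sub_dotProduct]

lemma bil_sub_right (V : Matrix (Fin k) (Fin k) ℝ) (x y y' : EuclideanSpace ℝ (Fin k)) :
    bil V x (y - y') = bil V x y - bil V x y' := by
  simp [bil, Matrix.mulVec_sub, dotProduct_sub]

lemma bil_smul_left (V : Matrix (Fin k) (Fin k) ℝ) (c : ℝ) (x y : EuclideanSpace ℝ (Fin k)) :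
    bil V (c • x) y = c * bil V x y := by
  simp [bil]

lemma bil_smul_right (V : Matrix (Fin k) (Fin k) ℝ) (c : ℝ) (x y : EuclideanSpace ℝ (Fin k)) :
    bil V x (c • y) = c * bil V x y := by
  simp [bil, Matrix.mulVec_smul]

lemma bil_comm {V : Matrix (Fin k) (Fin k) ℝ} (hV : V.IsSymm) (x y : EuclideanSpace ℝ (Fin k)) :
    bil V x y = bil V y x := by
  rw [bil, bil, dotProduct_comm, ← Matrix.vecMul_transpose, hV.eq, ← Matrix.dotProduct_mulVec]

lemma bil_self_pos {V : Matrix (Fin k) (Fin k) ℝ} (hV : V.PosDef)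
    {x : EuclideanSpace ℝ (Fin k)} (hx : x ≠ 0) : 0 < bil V x x := by
  have h : x.ofLp ≠ 0 := by simpa using hx
  simpa [bil] using hV.dotProduct_mulVec_pos h

variable [NeZero k]

lemma bil_e1_left (V : Matrix (Fin k) (Fin k) ℝ) (y : EuclideanSpace ℝ (Fin k)) :
    bil V e1 y = (V *ᵥ y.ofLp) 0 := by
  simp [bil, e1]

lemma e1_ne_zero : (e1 : EuclideanSpace ℝ (Fin k)) ≠ 0 := by
  simp [e1]

lemma inner_e1_left (x : EuclideanSpace ℝ (Fin k)) : inner ℝ e1 x = x 0 := by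
  simp [e1, EuclideanSpace.inner_single_left]

/-- The norm hypothesis says that `a` is not a multiple of `e1`. This makes the equality-imposed
variance positive. -/
lemma ne_smul_of_norm_pos {a : EuclideanSpace ℝ (Fin k)} (ha : 0 < ‖(a 0) • e1 - a‖) (t : ℝ) :
    e1 - t • a ≠ 0 := by
  intro h
  rw [sub_eq_zero] at h
  have h0 : (1 : ℝ) = t * a 0 := by
    have := congrArg (fun x : EuclideanSpace ℝ (Fin k) => x 0) h
    simpa [e1] using this
  rw [h, smul_smul, mul_comm, ← h0, one_smul, sub_self, norm_zero] at ha
  exact lt_irrefl _ ha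

lemma ne_zero_of_norm_pos {a : EuclideanSpace ℝ (Fin k)} (ha : 0 < ‖(a 0) • e1 - a‖) :
    a ≠ 0 := by
  rintro rfl
  simp at ha

/-- The asymptotic variance of the first coordinate of the equality-imposed estimator. -/
noncomputable def eqVar (V : Matrix (Fin k) (Fin k) ℝ) (a : EuclideanSpace ℝ (Fin k)) : ℝ :=
  bil V e1 e1 - bil V e1 a * (bil V a a)⁻¹ * bil V a e1

/-- This is the squared length of the residual of `e1` after projection on `a` in the inner product
given by `V`. -/
lemma eqVar_eq_bil {V : Matrix (Fin k) (Fin k) ℝ} (hV : V.IsSymm) {a : EuclideanSpace ℝ (Fin k)}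
    (ha : bil V a a ≠ 0) :
    eqVar V a = bil V (e1 - (bil V e1 a / bil V a a) • a) (e1 - (bil V e1 a / bil V a a) • a) := by
  simp only [eqVar, bil_sub_left, bil_sub_right, bil_smul_left, bil_smul_right, bil_comm hV a e1]
  field_simp
  ring

lemma eqVar_pos {V : Matrix (Fin k) (Fin k) ℝ} (hV : V.PosDef) {a : EuclideanSpace ℝ (Fin k)}
    (ha : 0 < ‖(a 0) • e1 - a‖) : 0 < eqVar V a := by
  have hs : V.IsSymm := by simpa using! hV.isHermitian
  rw [eqVar_eq_bil hs (bil_self_pos hV (ne_zero_of_norm_pos ha)).ne']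
  exact bil_self_pos hV (ne_smul_of_norm_pos ha _)

/-- The limit of the threshold multiplied by the square root of the sample size. -/
noncomputable def scaledThreshold (z : ℝ) (V : Matrix (Fin k) (Fin k) ℝ)
    (a : EuclideanSpace ℝ (Fin k)) : ℝ :=
  bil V e1 a * z / (√(bil V e1 e1) + √(eqVar V a))

/-- Both sides come from σ² − τ² = (e₁'Va)²/(a'Va), factored as a difference of squares. The
identity is what joins the two branches of each endpoint continuously. -/
lemma slope_mul_scaledThreshold (z : ℝ) {V : Matrix (Fin k) (Fin k) ℝ} (hV : V.IsSymm)
    {a : EuclideanSpace ℝ (Fin k)} (h1 : 0 < bil V e1 e1) (hτ : 0 < eqVar V a) :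
    bil V e1 a / bil V a a * scaledThreshold z V a =
      (√(bil V e1 e1) - √(eqVar V a)) * z := by
  have hs : 0 < √(bil V e1 e1) := Real.sqrt_pos.2 h1
  have ht : 0 < √(eqVar V a) := Real.sqrt_pos.2 hτ
  have e : bil V e1 a / bil V a a * bil V e1 a =
      (√(bil V e1 e1) - √(eqVar V a)) * (√(bil V e1 e1) + √(eqVar V a)) := by
    have : (√(bil V e1 e1) - √(eqVar V a)) * (√(bil V e1 e1) + √(eqVar V a)) =
      √(bil V e1 e1) ^ 2 - √(eqVar V a) ^ 2 := by ring
    rw [this, Real.sq_sqrt h1.le, Real.sq_sqrt hτ.le, eqVar, bil_comm hV a e1]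
    ring
  rw [scaledThreshold, mul_div_assoc', div_eq_iff (by positivity), ← mul_assoc, e]
  ring

/-- Rationalizing σ − τ cancels the division by e₁'Va: the result is continuous across e₁'Va = 0 and
absorbs the case distinction in `threshold`. -/
lemma threshold_eq (α : ℝ) (n : ℕ) {V : Matrix (Fin k) (Fin k) ℝ} (hV : V.IsSymm)
    {a : EuclideanSpace ℝ (Fin k)} (h1 : 0 < bil V e1 e1) (ha : 0 < bil V a a)
    (hτ : 0 < eqVar V a) :
    threshold α n V a = (√(n : ℝ))⁻¹ * scaledThreshold (stdNormalQuantile (1 - α / 2)) V a := by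
  rw [threshold]
  split_ifs with hv
  · have h := slope_mul_scaledThreshold (stdNormalQuantile (1 - α / 2)) hV h1 hτ
    have h' : scaledThreshold (stdNormalQuantile (1 - α / 2)) V a =
        (bil V e1 a)⁻¹ * bil V a a *
          ((√(bil V e1 e1) - √(eqVar V a)) * stdNormalQuantile (1 - α / 2)) := by
      rw [← h]
      field_simp
    rw [h', usualSE, eqSE, ← eqVar]
    ring
  · rw [not_not] at hv
    simp [scaledThreshold, hv]

/-- The margin by which the true value lies inside the interval, after scaling by the square root
of the sample size: `x` is the scaled estimation error of the parameter, `T` the scaled value of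
the constraint function, `b` the slope, `c` the scaled threshold and `s` the scaled half-width. -/
noncomputable def margin (b c s T x : ℝ) : ℝ :=
  min (s + b * max (T - c) 0 - x) (s - b * max (T + c) 0 + x)

/-- Since bc = (σ − τ)z, passing to the equality-imposed branch changes a scaled endpoint by −b(T ∓
c), which vanishes at the switch; the positive parts in `margin` thus encode both cases. -/
lemma mem_interval_iff_margin (α : ℝ) {n : ℕ} (hn : 0 < n) {V : Matrix (Fin k) (Fin k) ℝ}
    (hV : V.IsSymm) {a : EuclideanSpace ℝ (Fin k)} (h1 : 0 < bil V e1 e1) (ha : 0 < bil V a a)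
    (hτ : 0 < eqVar V a) (t θ : EuclideanSpace ℝ (Fin k)) (y : ℝ) :
    θ 0 ∈ Set.Icc (lowerEnd α n V t a y) (upperEnd α n V t a y) ↔
      0 ≤ margin (bil V e1 a / bil V a a) (scaledThreshold (stdNormalQuantile (1 - α / 2)) V a)
        (√(bil V e1 e1) * stdNormalQuantile (1 - α / 2)) (√(n : ℝ) * y)
        (√(n : ℝ) * (t 0 - θ 0)) := by
  have hN : 0 < √(n : ℝ) := Real.sqrt_pos.2 (by exact_mod_cast hn)
  have hbc := slope_mul_scaledThreshold (stdNormalQuantile (1 - α / 2)) hV h1 hτ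
  have hest : eqEstimator V t a y 0 = t 0 - bil V e1 a / bil V a a * y := by
    simp only [eqEstimator, PiLp.sub_apply, PiLp.smul_apply, smul_eq_mul, ← bil_e1_left]
    ring
  rw [lowerEnd, upperEnd, threshold_eq α n hV h1 ha hτ, hest, usualSE, eqSE, ← eqVar, Set.mem_Icc,
    margin, le_min_iff]
  set N := √(n : ℝ)
  set σ := √(bil V e1 e1)
  set τ := √(eqVar V a)
  set z := stdNormalQuantile (1 - α / 2)
  set b := bil V e1 a / bil V a a
  set c := scaledThreshold z V a
  have hscale : ∀ r q : ℝ, r ≤ N⁻¹ * q ↔ N * r ≤ q := fun r q => by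
    rw [inv_mul_eq_div, le_div_iff₀ hN, mul_comm]
  have hNi : ∀ r : ℝ, N * (N⁻¹ * r) = r := fun r => mul_inv_cancel_left₀ hN.ne' r
  refine and_congr ?_ ?_
  · split_ifs with h
    · rw [hscale] at h
      rw [max_eq_right (by linarith), ← mul_le_mul_iff_right₀ hN]
      have := hNi (σ * z)
      constructor <;> intro h' <;> nlinarith
    · rw [hscale, not_le] at h
      rw [max_eq_left (by linarith), ← mul_le_mul_iff_right₀ hN]
      have := hNi (τ * z)
      constructor <;> intro h' <;> nlinarith
  · split_ifs with h
    · rw [← mul_neg, hscale] at h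
      rw [max_eq_right (by linarith), ← mul_le_mul_iff_right₀ hN]
      have := hNi (σ * z)
      constructor <;> intro h' <;> nlinarith
    · rw [← mul_neg, hscale, not_le] at h
      rw [max_eq_left (by linarith), ← mul_le_mul_iff_right₀ hN]
      have := hNi (τ * z)
      constructor <;> intro h' <;> nlinarith

end Bil

/-! ### Coverage in the limiting Gaussian experiment. -/

section Limit

variable {k : ℕ} {V : Matrix (Fin k) (Fin k) ℝ}

lemma multivariateGaussian_map_inner (hV : V.PosDef) (y : EuclideanSpace ℝ (Fin k)) :
    (multivariateGaussian 0 V).map (fun x => inner ℝ y x) =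
      gaussianReal 0 (bil V y y).toNNReal := by
  have h := IsGaussian.map_eq_gaussianReal (μ := multivariateGaussian 0 V) (innerSL ℝ y)
  have h1 : (multivariateGaussian 0 V)[innerSL ℝ y] = 0 := by
    rw [(innerSL ℝ y).integral_comp_id_comm IsGaussian.integrable_id]
    simp
  have h2 : Var[innerSL ℝ y; multivariateGaussian 0 V] = bil V y y := by
    rw [bil, ← covarianceBilin_multivariateGaussian (μ := 0) hV.posSemidef,
      covarianceBilin_self IsGaussian.memLp_two_id]
    rfl
  rw [h1, h2] at h
  exact h

/-- The covariance of the sum and the difference is the difference of the two unit variances, hence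
0; joint Gaussianity turns this into independence. -/
lemma multivariateGaussian_map_inner_pair (hV : V.PosDef) {y₁ y₂ : EuclideanSpace ℝ (Fin k)}
    (h₁ : bil V y₁ y₁ = 1) (h₂ : bil V y₂ y₂ = 1) :
    ∃ p q, (multivariateGaussian 0 V).map (fun x => (inner ℝ y₁ x, inner ℝ y₂ x)) =
        sumDiffLaw p q ∧
      (sumDiffLaw p q).map Prod.fst = gaussianReal 0 1 ∧
      (sumDiffLaw p q).map Prod.snd = gaussianReal 0 1 := by
  have hs : V.IsSymm := by simpa using! hV.isHermitian
  have hlaw : HasGaussianLaw (fun x : EuclideanSpace ℝ (Fin k) =>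
      (inner ℝ (y₁ + y₂) x, inner ℝ (y₁ - y₂) x)) (multivariateGaussian 0 V) :=
    IsGaussian.hasGaussianLaw_id.map_fun ((innerSL ℝ (y₁ + y₂)).prod (innerSL ℝ (y₁ - y₂)))
  have hcov : cov[fun x => inner ℝ (y₁ + y₂) x, fun x => inner ℝ (y₁ - y₂) x;
      multivariateGaussian 0 V] = 0 := by
    rw [← covarianceBilin_apply_eq_cov IsGaussian.memLp_two_id,
      covarianceBilin_multivariateGaussian hV.posSemidef]
    change bil V (y₁ + y₂) (y₁ - y₂) = 0
    rw [bil_add_left, bil_sub_right, bil_sub_right, h₁, h₂, bil_comm hs y₂ y₁]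
    ring
  have hind := hlaw.indepFun_of_covariance_eq_zero hcov
  rw [indepFun_iff_map_prod_eq_prod_map_map (by fun_prop) (by fun_prop),
    multivariateGaussian_map_inner hV, multivariateGaussian_map_inner hV] at hind
  have key : (multivariateGaussian 0 V).map (fun x => (inner ℝ y₁ x, inner ℝ y₂ x)) =
      sumDiffLaw (bil V (y₁ + y₂) (y₁ + y₂)).toNNReal (bil V (y₁ - y₂) (y₁ - y₂)).toNNReal := by
    rw [sumDiffLaw, ← hind, Measure.map_map (by fun_prop) (by fun_prop)]
    congr 1
    ext x <;> simp [inner_add_left, inner_sub_left]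
  refine ⟨_, _, key, ?_, ?_⟩
  · rw [← key, Measure.map_map (by fun_prop) (by fun_prop)]
    have := multivariateGaussian_map_inner hV y₁
    rw [h₁, Real.toNNReal_one] at this
    exact this
  · rw [← key, Measure.map_map (by fun_prop) (by fun_prop)]
    have := multivariateGaussian_map_inner hV y₂
    rw [h₂, Real.toNNReal_one] at this
    exact this

lemma multivariateGaussian_inner_eq_null (hV : V.PosDef) {y : EuclideanSpace ℝ (Fin k)}
    (hy : bil V y y = 1) (r : ℝ) :
    multivariateGaussian 0 V {x | inner ℝ y x = r} = 0 := by
  have h := multivariateGaussian_map_inner hV y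
  rw [hy, Real.toNNReal_one] at h
  have := nullSingletonClass_gaussianReal (μ := 0) one_ne_zero
  have h0 : gaussianReal 0 1 {r} = 0 := measure_singleton r
  rw [← h, Measure.map_apply (by fun_prop) (measurableSet_singleton r)] at h0
  exact h0

variable [NeZero k]

/-- The standardized directions of the estimator and of the equality-imposed estimator. -/
lemma exists_standardized_directions (hV : V.PosDef) {a : EuclideanSpace ℝ (Fin k)}
    (ha : 0 < ‖(a 0) • e1 - a‖) :
    ∃ y₁ y₂ : EuclideanSpace ℝ (Fin k), bil V y₁ y₁ = 1 ∧ bil V y₂ y₂ = 1 ∧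
      (∀ x : EuclideanSpace ℝ (Fin k), x 0 = √(bil V e1 e1) * inner ℝ y₁ x) ∧
      ∀ x : EuclideanSpace ℝ (Fin k),
        x 0 - bil V e1 a / bil V a a * inner ℝ a x = √(eqVar V a) * inner ℝ y₂ x := by
  have hs : V.IsSymm := by simpa using! hV.isHermitian
  have h1 : 0 < bil V e1 e1 := bil_self_pos hV e1_ne_zero
  have hτ := eqVar_pos hV ha
  have hw := bil_self_pos hV (ne_zero_of_norm_pos ha)
  refine ⟨(√(bil V e1 e1))⁻¹ • e1,
    (√(eqVar V a))⁻¹ • (e1 - (bil V e1 a / bil V a a) • a), ?_, ?_, fun x => ?_, fun x => ?_⟩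
  · rw [bil_smul_left, bil_smul_right, ← mul_assoc, ← mul_inv, Real.mul_self_sqrt h1.le,
      inv_mul_cancel₀ h1.ne']
  · rw [bil_smul_left, bil_smul_right, ← mul_assoc, ← mul_inv, Real.mul_self_sqrt hτ.le,
      ← eqVar_eq_bil hs hw.ne', inv_mul_cancel₀ hτ.ne']
  · rw [real_inner_smul_left, inner_e1_left, mul_inv_cancel_left₀ (Real.sqrt_pos.2 h1).ne']
  · rw [real_inner_smul_left, mul_inv_cancel_left₀ (Real.sqrt_pos.2 hτ).ne', inner_sub_left,
      inner_e1_left, real_inner_smul_left]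

/-- For `b ≥ 0` the slope moves inside the maxima. The maximum that relaxes its bound becomes a
disjunction, the one that tightens its bound a conjunction. -/
lemma margin_nonneg_iff_of_nonneg {b c σ τ z h T x X₁ X₂ : ℝ} (hb : 0 ≤ b) (hσ : 0 < σ)
    (hτ : 0 < τ) (hbc : b * c = (σ - τ) * z) (hx : x = σ * X₁) (hT : x - b * T = τ * X₂) :
    0 ≤ margin b c (σ * z) (T + h) x ↔ (X₁, X₂) ∈ acceptRegion z (-(b * h) / τ) := by
  have e1 : b * (T + h - c) = σ * X₁ - τ * X₂ + b * h - (σ - τ) * z := by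
    rw [← hbc, ← hT, ← hx]; ring
  have e2 : b * (T + h + c) = σ * X₁ - τ * X₂ + b * h + (σ - τ) * z := by
    rw [← hbc, ← hT, ← hx]; ring
  have hd : τ * (-(b * h) / τ) = -(b * h) := by field_simp
  rw [margin, le_min_iff, mul_max_of_nonneg _ _ hb, mul_max_of_nonneg _ _ hb, mul_zero, e1, e2, hx]
  simp only [acceptRegion, Set.mem_ofPred_eq]
  have i1 : X₁ ≤ z ↔ σ * X₁ ≤ σ * z := (mul_le_mul_iff_right₀ hσ).symm
  have i2 : X₂ ≤ z - -(b * h) / τ ↔ τ * X₂ ≤ τ * (z - -(b * h) / τ) :=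
    (mul_le_mul_iff_right₀ hτ).symm
  have i3 : -X₁ ≤ z ↔ σ * -X₁ ≤ σ * z := (mul_le_mul_iff_right₀ hσ).symm
  have i4 : -X₂ ≤ z + -(b * h) / τ ↔ τ * -X₂ ≤ τ * (z + -(b * h) / τ) :=
    (mul_le_mul_iff_right₀ hτ).symm
  rw [i1, i2, i3, i4, mul_sub, mul_add, hd]
  refine and_congr ?_ ?_
  · constructor
    · intro h0
      rcases max_cases (σ * X₁ - τ * X₂ + b * h - (σ - τ) * z) 0 with ⟨h1, -⟩ | ⟨h1, -⟩
      · right; rw [h1] at h0; linarith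
      · left; rw [h1] at h0; linarith
    · rintro (h0 | h0)
      · have := le_max_right (σ * X₁ - τ * X₂ + b * h - (σ - τ) * z) 0
        linarith
      · have := le_max_left (σ * X₁ - τ * X₂ + b * h - (σ - τ) * z) 0
        linarith
  · constructor
    · intro h0
      have h1 := le_max_right (σ * X₁ - τ * X₂ + b * h + (σ - τ) * z) 0
      have h2 := le_max_left (σ * X₁ - τ * X₂ + b * h + (σ - τ) * z) 0
      constructor <;> linarith
    · rintro ⟨h1, h2⟩
      rcases max_cases (σ * X₁ - τ * X₂ + b * h + (σ - τ) * z) 0 with ⟨h3, -⟩ | ⟨h3, -⟩ <;>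
        rw [h3] <;> linarith

/-- Changing the sign of the first coordinate exchanges the two endpoints; this reduces negative
slopes to positive ones. -/
lemma margin_neg (b c s T x : ℝ) : margin (-b) (-c) s T (-x) = margin b c s T x := by
  rw [margin, margin, min_comm]
  congr 1 <;> ring_nf

/-- A zero margin puts `X₁` or `X₂` at one of four fixed values, whatever the sign of `b`, so it has
Gaussian probability zero. -/
lemma eq_of_margin_eq_zero {b c σ τ z h T x X₁ X₂ : ℝ} (hσ : 0 < σ)
    (hτ : 0 < τ) (hbc : b * c = (σ - τ) * z) (hx : x = σ * X₁) (hT : x - b * T = τ * X₂)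
    (hm : margin b c (σ * z) (T + h) x = 0) :
    (X₁ = z ∨ X₁ = -z) ∨ X₂ = (τ * z + b * h) / τ ∨ X₂ = (-(τ * z) + b * h) / τ := by
  have c1 : ∀ r, σ * X₁ = σ * r → X₁ = r := fun r hr => mul_left_cancel₀ hσ.ne' hr
  have c2 : ∀ r, τ * X₂ = r → X₂ = r / τ := fun r hr => by
    rw [eq_div_iff hτ.ne', mul_comm]; exact hr
  rw [margin] at hm
  rcases min_cases (σ * z + b * max (T + h - c) 0 - x) (σ * z - b * max (T + h + c) 0 + x) with
    ⟨h1, -⟩ | ⟨h1, -⟩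
  · rw [h1] at hm
    rcases max_cases (T + h - c) 0 with ⟨h2, -⟩ | ⟨h2, -⟩ <;> rw [h2] at hm
    · exact Or.inr (Or.inl (c2 _ (by linarith)))
    · exact Or.inl (Or.inl (c1 _ (by linarith)))
  · rw [h1] at hm
    rcases max_cases (T + h + c) 0 with ⟨h2, -⟩ | ⟨h2, -⟩ <;> rw [h2] at hm
    · exact Or.inr (Or.inr (c2 _ (by linarith)))
    · exact Or.inl (Or.inr (c1 _ (by linarith)))

/-- The limit of the margin when the scaled value of the constraint converges to `h`. -/
noncomputable def limitMargin (z h : ℝ) (V : Matrix (Fin k) (Fin k) ℝ)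
    (a x : EuclideanSpace ℝ (Fin k)) : ℝ :=
  margin (bil V e1 a / bil V a a) (scaledThreshold z V a) (√(bil V e1 e1) * z)
    (inner ℝ a x + h) (x 0)

lemma limitMargin_eq_zero_null (hV : V.PosDef) {a : EuclideanSpace ℝ (Fin k)}
    (ha : 0 < ‖(a 0) • e1 - a‖) (z h : ℝ) :
    multivariateGaussian 0 V {x | limitMargin z h V a x = 0} = 0 := by
  have hs : V.IsSymm := by simpa using! hV.isHermitian
  have h1 : 0 < bil V e1 e1 := bil_self_pos hV e1_ne_zero
  have hτ := eqVar_pos hV ha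
  obtain ⟨y₁, y₂, hy₁, hy₂, hx₁, hx₂⟩ := exists_standardized_directions hV ha
  refine measure_mono_null (fun x hx => ?_) (measure_union_null
    (measure_union_null (multivariateGaussian_inner_eq_null hV hy₁ z)
      (multivariateGaussian_inner_eq_null hV hy₁ (-z)))
    (measure_union_null
      (multivariateGaussian_inner_eq_null hV hy₂
        ((√(eqVar V a) * z + bil V e1 a / bil V a a * h) / √(eqVar V a)))
      (multivariateGaussian_inner_eq_null hV hy₂
        ((-(√(eqVar V a) * z) + bil V e1 a / bil V a a * h) / √(eqVar V a)))))
  exact eq_of_margin_eq_zero (Real.sqrt_pos.2 h1) (Real.sqrt_pos.2 hτ)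
    (slope_mul_scaledThreshold z hs h1 hτ) (hx₁ x) (hx₂ x) hx

/-- The event of a nonnegative limiting margin is the acceptance region in suitable standardized
coordinates. -/
lemma exists_measure_limitMargin_eq (hV : V.PosDef) {a : EuclideanSpace ℝ (Fin k)}
    (ha : 0 < ‖(a 0) • e1 - a‖) (z : ℝ) {h : ℝ} (hh : h ≤ 0) :
    ∃ (p q : NNReal) (δ : ℝ), (sumDiffLaw p q).map Prod.fst = gaussianReal 0 1 ∧
      (sumDiffLaw p q).map Prod.snd = gaussianReal 0 1 ∧ 0 ≤ δ ∧ (h = 0 → δ = 0) ∧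
      multivariateGaussian 0 V {x | 0 ≤ limitMargin z h V a x} =
        sumDiffLaw p q (acceptRegion z δ) := by
  have hs : V.IsSymm := by simpa using! hV.isHermitian
  have h1 : 0 < bil V e1 e1 := bil_self_pos hV e1_ne_zero
  have hτ := eqVar_pos hV ha
  have hσ' := Real.sqrt_pos.2 h1
  have hτ' := Real.sqrt_pos.2 hτ
  have hbc := slope_mul_scaledThreshold z hs h1 hτ
  obtain ⟨y₁, y₂, hy₁, hy₂, hx₁, hx₂⟩ := exists_standardized_directions hV ha
  rcases le_total 0 (bil V e1 a / bil V a a) with hb | hb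
  · obtain ⟨p, q, hpq, hp, hq⟩ := multivariateGaussian_map_inner_pair hV hy₁ hy₂
    refine ⟨p, q, -(bil V e1 a / bil V a a * h) / √(eqVar V a), hp, hq,
      div_nonneg (neg_nonneg.2 (mul_nonpos_of_nonneg_of_nonpos hb hh)) hτ'.le,
      fun h0 => by simp [h0], ?_⟩
    rw [← hpq, Measure.map_apply (by fun_prop) (measurableSet_acceptRegion _ _)]
    congr 1
    ext x
    exact margin_nonneg_iff_of_nonneg hb hσ' hτ' hbc (hx₁ x) (hx₂ x)
  -- For a negative slope the standardized directions are negated, and `margin_neg` restores the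
  -- case treated above.
  · have hy₁' : bil V (-y₁) (-y₁) = 1 := by
      rw [← neg_one_smul ℝ, bil_smul_left, bil_smul_right, hy₁]; norm_num
    have hy₂' : bil V (-y₂) (-y₂) = 1 := by
      rw [← neg_one_smul ℝ, bil_smul_left, bil_smul_right, hy₂]; norm_num
    obtain ⟨p, q, hpq, hp, hq⟩ := multivariateGaussian_map_inner_pair hV hy₁' hy₂'
    have hb' : 0 ≤ -(bil V e1 a / bil V a a) := neg_nonneg.2 hb
    refine ⟨p, q, -(-(bil V e1 a / bil V a a) * h) / √(eqVar V a), hp, hq,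
      div_nonneg (neg_nonneg.2 (mul_nonpos_of_nonneg_of_nonpos hb' hh)) hτ'.le,
      fun h0 => by simp [h0], ?_⟩
    rw [← hpq, Measure.map_apply (by fun_prop) (measurableSet_acceptRegion _ _)]
    congr 1
    ext x
    have := margin_nonneg_iff_of_nonneg (c := -scaledThreshold z V a) (x := -x 0)
      (T := inner ℝ a x) (h := h) (X₁ := inner ℝ (-y₁) x) (X₂ := inner ℝ (-y₂) x) hb' hσ' hτ'
      (by rw [neg_mul_neg, hbc]) (by rw [inner_neg_left, hx₁]; ring)
      (by rw [inner_neg_left, mul_neg, ← hx₂]; ring)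
    rw [margin_neg] at this
    exact this

lemma le_measure_limitMargin (hV : V.PosDef) {a : EuclideanSpace ℝ (Fin k)}
    (ha : 0 < ‖(a 0) • e1 - a‖) {α : ℝ} (h0 : 0 < α) (h1 : α < 1) {h : ℝ} (hh : h ≤ 0) :
    ENNReal.ofReal (1 - α) ≤ multivariateGaussian 0 V
      {x | 0 ≤ limitMargin (stdNormalQuantile (1 - α / 2)) h V a x} := by
  obtain ⟨p, q, δ, hp, hq, hδ, -, he⟩ := exists_measure_limitMargin_eq hV ha
    (stdNormalQuantile (1 - α / 2)) hh
  rw [he]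
  exact le_sumDiffLaw_acceptRegion hp hq h0.le (stdNormalQuantile_nonneg (by linarith))
    (gaussianReal_Ioi_stdNormalQuantile h0 h1) hδ

lemma measure_limitMargin_zero (hV : V.PosDef) {a : EuclideanSpace ℝ (Fin k)}
    (ha : 0 < ‖(a 0) • e1 - a‖) {α : ℝ} (h0 : 0 < α) (h1 : α < 1) :
    multivariateGaussian 0 V {x | 0 ≤ limitMargin (stdNormalQuantile (1 - α / 2)) 0 V a x} =
      ENNReal.ofReal (1 - α) := by
  obtain ⟨p, q, δ, hp, hq, -, hδ, he⟩ := exists_measure_limitMargin_eq hV ha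
    (stdNormalQuantile (1 - α / 2)) le_rfl
  rw [he, hδ rfl]
  exact sumDiffLaw_acceptRegion_zero hp hq h0.le (stdNormalQuantile_nonneg (by linarith))
    (gaussianReal_Ioi_stdNormalQuantile h0 h1)

lemma measure_usual_margin (hV : V.PosDef) {α : ℝ} (h0 : 0 < α) (h1 : α < 1) :
    multivariateGaussian 0 V
        {x | 0 ≤ √(bil V e1 e1) * stdNormalQuantile (1 - α / 2) - |x 0|} =
      ENNReal.ofReal (1 - α) := by
  have hp : 0 < bil V e1 e1 := bil_self_pos hV e1_ne_zero
  have hσ := Real.sqrt_pos.2 hp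
  have hy : bil V ((√(bil V e1 e1))⁻¹ • e1) ((√(bil V e1 e1))⁻¹ • e1) = 1 := by
    rw [bil_smul_left, bil_smul_right, ← mul_assoc, ← mul_inv, Real.mul_self_sqrt hp.le,
      inv_mul_cancel₀ hp.ne']
  have hlaw := multivariateGaussian_map_inner hV ((√(bil V e1 e1))⁻¹ • e1)
  rw [hy, Real.toNNReal_one] at hlaw
  rw [← gaussianReal_abs_le h0.le (stdNormalQuantile_nonneg (p := 1 - α / 2) (by linarith))
    (gaussianReal_Ioi_stdNormalQuantile h0 h1), ← hlaw,
    Measure.map_apply (by fun_prop) (measurableSet_le (by fun_prop) (by fun_prop))]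
  congr 1
  ext x
  simp only [Set.mem_preimage, Set.mem_ofPred_eq, real_inner_smul_left, inner_e1_left, abs_mul,
    abs_inv, abs_of_pos hσ, sub_nonneg]
  rw [inv_mul_le_iff₀ hσ]

lemma usual_margin_eq_zero_null (hV : V.PosDef) (z : ℝ) :
    multivariateGaussian 0 V {x | √(bil V e1 e1) * z - |x 0| = 0} = 0 := by
  have hp : 0 < bil V e1 e1 := bil_self_pos hV e1_ne_zero
  have hσ := Real.sqrt_pos.2 hp
  have hy : bil V ((√(bil V e1 e1))⁻¹ • e1) ((√(bil V e1 e1))⁻¹ • e1) = 1 := by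
    rw [bil_smul_left, bil_smul_right, ← mul_assoc, ← mul_inv, Real.mul_self_sqrt hp.le,
      inv_mul_cancel₀ hp.ne']
  refine measure_mono_null (fun x hx => ?_) (measure_union_null
    (multivariateGaussian_inner_eq_null hV hy z) (multivariateGaussian_inner_eq_null hV hy (-z)))
  simp only [Set.mem_union, Set.mem_ofPred_eq, real_inner_smul_left, inner_e1_left] at hx ⊢
  rw [inv_mul_eq_iff_eq_mul₀ hσ.ne', inv_mul_eq_iff_eq_mul₀ hσ.ne', mul_neg]
  exact eq_or_eq_neg_of_abs_eq (sub_eq_zero.1 hx).symm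

end Limit

/-! ### Linearization and limits of coverage along a sequence. -/

/-- The mean value inequality on a convex ball, with `G` within ε of its value at the centre. The
radius δ does not depend on `x`, as needed when the true parameter moves with the sample size. -/
lemma exists_forall_abs_sub_sub_inner_le {E : Type*} [NormedAddCommGroup E] [InnerProductSpace ℝ E]
    [CompleteSpace E] {g : E → ℝ} {G : E → E} {U : Set E}
    (hg : ∀ x ∈ U, HasGradientWithinAt g (G x) U x) (hG : UniformContinuousOn G U) {ε : ℝ}
    (hε : 0 < ε) :
    ∃ δ : ℝ, 0 < δ ∧ ∀ (x : E) (r : ℝ), r ≤ δ → Metric.ball x r ⊆ U → ∀ y ∈ Metric.ball x r,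
      |g y - g x - inner ℝ (G x) (y - x)| ≤ ε * ‖y - x‖ := by
  obtain ⟨δ, hδ, h⟩ := Metric.uniformContinuousOn_iff.1 hG ε hε
  refine ⟨δ, hδ, fun x r hr hU y hy => ?_⟩
  have hr0 : 0 < r := dist_nonneg.trans_lt hy
  have hx : x ∈ Metric.ball x r := Metric.mem_ball_self hr0
  have key := (convex_ball x r).norm_image_sub_le_of_norm_hasFDerivWithin_le'
    (f := g) (f' := fun t => InnerProductSpace.toDual ℝ E (G t))
    (φ := InnerProductSpace.toDual ℝ E (G x)) (C := ε)
    (fun t ht => (hg t (hU ht)).hasFDerivWithinAt.mono hU)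
    (fun t ht => by
      rw [← map_sub, LinearIsometryEquiv.norm_map, ← dist_eq_norm]
      exact (h t (hU ht) x (hU hx) ((Metric.mem_ball.1 ht).trans_le hr)).le) hx hy
  simpa using key

section Asymptotics

variable {k : ℕ}

lemma continuous_bil : Continuous fun p : Matrix (Fin k) (Fin k) ℝ × EuclideanSpace ℝ (Fin k) ×
    EuclideanSpace ℝ (Fin k) => bil p.1 p.2.1 p.2.2 := by
  unfold bil
  refine Continuous.dotProduct ?_ (Continuous.matrix_mulVec continuous_fst ?_) <;> fun_prop

lemma tendsto_bil {β : Type*} {L : Filter β} {W : β → Matrix (Fin k) (Fin k) ℝ}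
    {V : Matrix (Fin k) (Fin k) ℝ} {x y : β → EuclideanSpace ℝ (Fin k)}
    {x₀ y₀ : EuclideanSpace ℝ (Fin k)} (hW : Tendsto W L (𝓝 V)) (hx : Tendsto x L (𝓝 x₀))
    (hy : Tendsto y L (𝓝 y₀)) :
    Tendsto (fun b => bil (W b) (x b) (y b)) L (𝓝 (bil V x₀ y₀)) :=
  (continuous_bil.tendsto (V, x₀, y₀)).comp (hW.prodMk_nhds (hx.prodMk_nhds hy))

lemma margin_nonneg_iff_of_le {b c s T x : ℝ} (hT : T ≤ -|c|) :
    0 ≤ margin b c s T x ↔ 0 ≤ s - |x| := by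
  have h1 := le_abs_self c
  have h2 := neg_abs_le c
  rw [margin, max_eq_right (by linarith), max_eq_right (by linarith), le_min_iff,
    sub_nonneg (b := |x|), abs_le]
  constructor
  · rintro ⟨h3, h4⟩; constructor <;> linarith
  · rintro ⟨h3, h4⟩; constructor <;> linarith

variable {Ω : ℕ → Type*} [∀ q, MeasurableSpace (Ω q)] {P : ∀ q, Measure (Ω q)}
  {N : ℕ → ℕ} {θ : ℕ → EuclideanSpace ℝ (Fin k)}
  {θhat : ∀ q, Ω q → EuclideanSpace ℝ (Fin k)} {Vhat : ∀ q, Ω q → Matrix (Fin k) (Fin k) ℝ}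
  {V : Matrix (Fin k) (Fin k) ℝ}

/-- The scaled estimation error. -/
noncomputable def scaledError (N : ℕ → ℕ) (θ : ℕ → EuclideanSpace ℝ (Fin k))
    (θhat : ∀ q, Ω q → EuclideanSpace ℝ (Fin k)) (q : ℕ) (ω : Ω q) : EuclideanSpace ℝ (Fin k) :=
  √(N q : ℝ) • (θhat q ω - θ q)

lemma tendsto_estimator_sub_whp (hN : Tendsto N atTop atTop)
    (hT : TightAlong P atTop (scaledError N θ θhat)) :
    Tendsto (fun x : Σ q, Ω q => θhat x.1 x.2 - θ x.1) (whp P atTop) (𝓝 0) := by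
  refine hT.tendsto_zero_of_le_mul fun ε hε => eventually_whp_of_eventually ?_
  have hsq : Tendsto (fun q => √(N q : ℝ)) atTop atTop :=
    Real.tendsto_sqrt_atTop.comp (tendsto_natCast_atTop_atTop.comp hN)
  filter_upwards [hsq.eventually_ge_atTop ε⁻¹] with q hq ω
  have h1 : 1 ≤ ε * √(N q : ℝ) := by
    calc 1 = ε * ε⁻¹ := (mul_inv_cancel₀ hε.ne').symm
      _ ≤ _ := by gcongr
  rw [scaledError, norm_smul, Real.norm_of_nonneg (Real.sqrt_nonneg _), ← mul_assoc]
  exact le_mul_of_one_le_left (norm_nonneg _) h1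

variable {g : EuclideanSpace ℝ (Fin k) → ℝ} {G : EuclideanSpace ℝ (Fin k) → EuclideanSpace ℝ (Fin k)}
  {U : Set (EuclideanSpace ℝ (Fin k))}

lemma eventually_mem_ball_whp
    (hθ : Tendsto (fun x : Σ q, Ω q => θhat x.1 x.2 - θ x.1) (whp P atTop) (𝓝 0)) {r : ℝ}
    (hr : 0 < r) : ∀ᶠ x in whp P atTop, θhat x.1 x.2 ∈ Metric.ball (θ x.1) r := by
  filter_upwards [NormedAddGroup.tendsto_nhds_zero.1 hθ r hr] with x hx
  rwa [Metric.mem_ball, dist_eq_norm]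

lemma tendsto_gradient_whp (hGunif : UniformContinuousOn G U) {ε : ℝ} (hε : 0 < ε)
    (hU : ∀ᶠ q in atTop, Metric.ball (θ q) ε ⊆ U)
    (hθ : Tendsto (fun x : Σ q, Ω q => θhat x.1 x.2 - θ x.1) (whp P atTop) (𝓝 0))
    {a : EuclideanSpace ℝ (Fin k)} (ha : Tendsto (fun q => G (θ q)) atTop (𝓝 a)) :
    Tendsto (fun x : Σ q, Ω q => G (θhat x.1 x.2)) (whp P atTop) (𝓝 a) := by
  have h1 : Tendsto (fun x : Σ q, Ω q => G (θ x.1)) (whp P atTop) (𝓝 a) :=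
    ha.comp tendsto_fst_whp
  refine h1.congr_dist ?_
  rw [Metric.tendsto_nhds]
  intro r hr
  obtain ⟨δ, hδ, h⟩ := Metric.uniformContinuousOn_iff.1 hGunif r hr
  filter_upwards [eventually_mem_ball_whp hθ hε, eventually_mem_ball_whp hθ hδ,
    tendsto_fst_whp.eventually hU] with x h1 h2 h3
  rw [Real.dist_0_eq_abs, abs_of_nonneg dist_nonneg, dist_comm]
  exact h _ (h3 h1) _ (h3 (Metric.mem_ball_self hε)) h2

/-- A delta method at a moving centre: the Taylor remainder and the replacement of `G (θ q)` by its
limit each cost at most r/2 times the norm of the tight scaled error. -/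
lemma tendsto_linearization_error_whp (hg : ∀ x ∈ U, HasGradientWithinAt g (G x) U x)
    (hGunif : UniformContinuousOn G U) {ε : ℝ} (hε : 0 < ε)
    (hU : ∀ᶠ q in atTop, Metric.ball (θ q) ε ⊆ U)
    (hT : TightAlong P atTop (scaledError N θ θhat))
    (hθ : Tendsto (fun x : Σ q, Ω q => θhat x.1 x.2 - θ x.1) (whp P atTop) (𝓝 0))
    {a : EuclideanSpace ℝ (Fin k)} (ha : Tendsto (fun q => G (θ q)) atTop (𝓝 a)) :
    Tendsto (fun x : Σ q, Ω q => √(N x.1 : ℝ) * g (θhat x.1 x.2) - √(N x.1 : ℝ) * g (θ x.1) -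
      inner ℝ a (scaledError N θ θhat x.1 x.2)) (whp P atTop) (𝓝 0) := by
  refine hT.tendsto_zero_of_le_mul fun r hr => ?_
  obtain ⟨δ, hδ, h⟩ := exists_forall_abs_sub_sub_inner_le hg hGunif (half_pos hr)
  have ha' : ∀ᶠ q in atTop, ‖G (θ q) - a‖ < r / 2 := by
    simpa [dist_eq_norm] using Metric.tendsto_nhds.1 ha (r / 2) (half_pos hr)
  filter_upwards [eventually_mem_ball_whp hθ (lt_min hε hδ), tendsto_fst_whp.eventually hU,
    tendsto_fst_whp.eventually ha'] with x h1 h2 h3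
  have h4 := h (θ x.1) (min ε δ) (min_le_right _ _)
    ((Metric.ball_subset_ball (min_le_left _ _)).trans h2) _ h1
  set D := θhat x.1 x.2 - θ x.1 with hD
  have e : √(N x.1 : ℝ) * g (θhat x.1 x.2) - √(N x.1 : ℝ) * g (θ x.1) -
      inner ℝ a (scaledError N θ θhat x.1 x.2) =
      √(N x.1 : ℝ) * ((g (θhat x.1 x.2) - g (θ x.1) - inner ℝ (G (θ x.1)) D) +
        inner ℝ (G (θ x.1) - a) D) := by
    rw [scaledError, ← hD, inner_smul_right, inner_sub_left]; ring
  rw [e, scaledError, ← hD, norm_mul, norm_smul, Real.norm_of_nonneg (Real.sqrt_nonneg _),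
    mul_left_comm]
  refine mul_le_mul_of_nonneg_left ?_ (Real.sqrt_nonneg _)
  calc _ ≤ |g (θhat x.1 x.2) - g (θ x.1) - inner ℝ (G (θ x.1)) D| +
        |inner ℝ (G (θ x.1) - a) D| := abs_add_le _ _
    _ ≤ r / 2 * ‖D‖ + r / 2 * ‖D‖ :=
        add_le_add h4 ((abs_real_inner_le_norm _ _).trans (by gcongr))
    _ = r * ‖D‖ := by ring

lemma tendsto_matrix_whp
    (hV : ∀ i j, ∀ ε : ℝ, 0 < ε →
      Tendsto (fun q => P q {ω | ε ≤ |Vhat q ω i j - V i j|}) atTop (𝓝 0)) :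
    Tendsto (fun x : Σ q, Ω q => Vhat x.1 x.2) (whp P atTop) (𝓝 V) := by
  refine tendsto_pi_nhds.2 fun i => tendsto_pi_nhds.2 fun j => ?_
  rw [Metric.tendsto_nhds]
  intro ε hε
  rw [eventually_whp]
  simpa [Real.dist_eq] using hV i j ε hε

variable [NeZero k] (α : ℝ)

/-- With probability tending to one, coverage is nonnegativity of the margin, whose coefficients
converge in probability. -/
lemma coverage_iff_margin_whp (hN : Tendsto N atTop atTop) (hVpos : V.PosDef)
    (hVsymm : ∀ q ω, (Vhat q ω).IsSymm) {ahat : (Σ q, Ω q) → EuclideanSpace ℝ (Fin k)}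
    (hV : Tendsto (fun x : Σ q, Ω q => Vhat x.1 x.2) (whp P atTop) (𝓝 V))
    {a : EuclideanSpace ℝ (Fin k)} (ha : Tendsto ahat (whp P atTop) (𝓝 a))
    (ha0 : 0 < ‖(a 0) • e1 - a‖) :
    ∃ b c s : (Σ q, Ω q) → ℝ,
      Tendsto b (whp P atTop) (𝓝 (bil V e1 a / bil V a a)) ∧
      Tendsto c (whp P atTop) (𝓝 (scaledThreshold (stdNormalQuantile (1 - α / 2)) V a)) ∧
      Tendsto s (whp P atTop) (𝓝 (√(bil V e1 e1) * stdNormalQuantile (1 - α / 2))) ∧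
      ∀ᶠ x in whp P atTop, ∀ y : ℝ,
        θ x.1 0 ∈ Set.Icc (lowerEnd α (N x.1) (Vhat x.1 x.2) (θhat x.1 x.2) (ahat x) y)
          (upperEnd α (N x.1) (Vhat x.1 x.2) (θhat x.1 x.2) (ahat x) y) ↔
        0 ≤ margin (b x) (c x) (s x) (√(N x.1 : ℝ) * y) (scaledError N θ θhat x.1 x.2 0) := by
  have h1 := bil_self_pos hVpos (e1_ne_zero (k := k))
  have hw := bil_self_pos hVpos (ne_zero_of_norm_pos ha0)
  have hτ := eqVar_pos hVpos ha0
  have t11 := tendsto_bil hV (tendsto_const_nhds (x := (e1 : EuclideanSpace ℝ (Fin k))))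
    (tendsto_const_nhds (x := (e1 : EuclideanSpace ℝ (Fin k))))
  have t1a := tendsto_bil hV (tendsto_const_nhds (x := (e1 : EuclideanSpace ℝ (Fin k)))) ha
  have ta1 := tendsto_bil hV ha (tendsto_const_nhds (x := (e1 : EuclideanSpace ℝ (Fin k))))
  have taa := tendsto_bil hV ha ha
  have tτ : Tendsto (fun x => eqVar (Vhat x.1 x.2) (ahat x)) (whp P atTop) (𝓝 (eqVar V a)) :=
    t11.sub ((t1a.mul (taa.inv₀ hw.ne')).mul ta1)
  refine ⟨_, _, _, t1a.div taa hw.ne',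
    (t1a.mul_const _).div (t11.sqrt.add tτ.sqrt)
      (add_pos (Real.sqrt_pos.2 h1) (Real.sqrt_pos.2 hτ)).ne', t11.sqrt.mul_const _, ?_⟩
  -- `Vhat` need not be positive definite; the three positivity conditions hold with probability
  -- tending to one because the limits are positive.
  filter_upwards [t11.eventually (lt_mem_nhds h1), taa.eventually (lt_mem_nhds hw),
    tτ.eventually (lt_mem_nhds hτ), tendsto_fst_whp.eventually (hN.eventually_gt_atTop 0)]
    with x h2 h3 h4 h5 y
  have := mem_interval_iff_margin α h5 (hVsymm x.1 x.2) h2 h3 h4 (θhat x.1 x.2) (θ x.1) y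
  rw [this]
  rfl

/-- The limit of the coverage probability along a sequence on which the scaled value of the
constraint function converges in `ℝ` or diverges to `-∞`. -/
lemma tendsto_coverage [∀ q, IsProbabilityMeasure (P q)] (hN : Tendsto N atTop atTop) (hVpos : V.PosDef)
    (hVsymm : ∀ q ω, (Vhat q ω).IsSymm)
    (hdist : TendstoInDistribution (scaledError N θ θhat) atTop
      (id : EuclideanSpace ℝ (Fin k) → EuclideanSpace ℝ (Fin k)) P (multivariateGaussian 0 V))
    (hVhat : ∀ i j, ∀ ε : ℝ, 0 < ε →
      Tendsto (fun q => P q {ω | ε ≤ |Vhat q ω i j - V i j|}) atTop (𝓝 0))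
    (hg : ∀ x ∈ U, HasGradientWithinAt g (G x) U x) (hGunif : UniformContinuousOn G U)
    {ε : ℝ} (hε : 0 < ε) (hU : ∀ᶠ q in atTop, Metric.ball (θ q) ε ⊆ U)
    {a : EuclideanSpace ℝ (Fin k)} (ha : Tendsto (fun q => G (θ q)) atTop (𝓝 a))
    (ha0 : 0 < ‖(a 0) • e1 - a‖) :
    (∀ h : ℝ, Tendsto (fun q => √(N q : ℝ) * g (θ q)) atTop (𝓝 h) →
      Tendsto (fun q => P q {ω | θ q 0 ∈ IICI α g G (N q) (θhat q ω) (Vhat q ω)}) atTop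
        (𝓝 (multivariateGaussian 0 V
          {x | 0 ≤ limitMargin (stdNormalQuantile (1 - α / 2)) h V a x}))) ∧
    (Tendsto (fun q => √(N q : ℝ) * g (θ q)) atTop atBot →
      Tendsto (fun q => P q {ω | θ q 0 ∈ IICI α g G (N q) (θhat q ω) (Vhat q ω)}) atTop
        (𝓝 (multivariateGaussian 0 V
          {x | 0 ≤ √(bil V e1 e1) * stdNormalQuantile (1 - α / 2) - |x 0|}))) := by
  have hT := tightAlong_of_tendstoInDistribution hdist
  have hθ := tendsto_estimator_sub_whp hN hT
  have hlin := tendsto_linearization_error_whp hg hGunif hε hU hT hθ ha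
  obtain ⟨b, c, s, hb, hc, hs, hcov⟩ := coverage_iff_margin_whp α (θ := θ) (θhat := θhat) hN hVpos
    hVsymm (tendsto_matrix_whp hVhat) (tendsto_gradient_whp hGunif hε hU hθ ha) ha0
  constructor
  · intro h hh
    -- The constraint value minus its random part a'Z tends in probability to the constant `h`, so
    -- it joins `b`, `c`, `s` as a parameter and only the scaled error stays random.
    have hr : Tendsto (fun x : Σ q, Ω q => √(N x.1 : ℝ) * g (θhat x.1 x.2) -
        inner ℝ a (scaledError N θ θhat x.1 x.2)) (whp P atTop) (𝓝 h) := by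
      have := hlin.add (hh.comp (tendsto_fst_whp (P := P)))
      rw [zero_add] at this
      refine this.congr fun x => ?_
      simp only [Function.comp_apply]
      ring
    have hΦ : Continuous fun w : EuclideanSpace ℝ (Fin k) × ℝ × ℝ × ℝ × ℝ =>
        margin w.2.1 w.2.2.1 w.2.2.2.1 (inner ℝ a w.1 + w.2.2.2.2) (w.1 0) := by
      unfold margin; fun_prop
    have key := tendsto_measure_nonneg hdist hΦ
      (hb.prodMk_nhds (hc.prodMk_nhds (hs.prodMk_nhds hr)))
      (A := fun q => {ω | θ q 0 ∈ IICI α g G (N q) (θhat q ω) (Vhat q ω)}) ?_ ?_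
    · rw [Measure.map_id] at key
      exact key
    · rw [Measure.map_id]
      exact limitMargin_eq_zero_null hVpos ha0 _ h
    · filter_upwards [hcov] with x hx
      rw [add_sub_cancel]
      exact hx _
  · intro hh
    -- The scaled constraint value is the deterministic term tending to −∞ plus a'Z, which is tight,
    -- plus a vanishing error.
    have hbot : ∀ K : ℝ, ∀ᶠ x : Σ q, Ω q in whp P atTop,
        √(N x.1 : ℝ) * g (θhat x.1 x.2) ≤ K := by
      intro K
      refine hT.eventually_whp fun M => ?_
      filter_upwards [hlin.eventually (gt_mem_nhds one_pos),
        tendsto_fst_whp.eventually (hh.eventually_le_atBot (K - 1 - ‖a‖ * M))] with x h1 h2 h3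
      have h4 := (real_inner_le_norm a (scaledError N θ θhat x.1 x.2)).trans
        (mul_le_mul_of_nonneg_left h3 (norm_nonneg a))
      linarith
    have hΦ : Continuous fun w : EuclideanSpace ℝ (Fin k) × ℝ => w.2 - |w.1 0| := by fun_prop
    have key := tendsto_measure_nonneg hdist hΦ hs
      (A := fun q => {ω | θ q 0 ∈ IICI α g G (N q) (θhat q ω) (Vhat q ω)}) ?_ ?_
    · rw [Measure.map_id] at key
      exact key
    · rw [Measure.map_id]
      exact usual_margin_eq_zero_null hVpos _
    · filter_upwards [hcov, hc.abs.eventually (gt_mem_nhds (lt_add_one _)), hbot (-(_ + 1))]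
        with x h1 h2 h3
      rw [← margin_nonneg_iff_of_le (b := b x) (c := c x) (T := √(N x.1 : ℝ) * g (θhat x.1 x.2))
        (by linarith)]
      exact h1 _

end Asymptotics

/-! ### Extraction of convergent subsequences. -/

section Subsequences

variable {k : ℕ} [NeZero k] {Ω : ℕ → Type*} [∀ n, MeasurableSpace (Ω n)] {𝔽 : Type*}
  {𝓕 : ℕ → Set 𝔽} {P : (n : ℕ) → 𝔽 → Measure (Ω n)} [∀ n F, IsProbabilityMeasure (P n F)]
  {θ : 𝔽 → EuclideanSpace ℝ (Fin k)}
  {θhat : (n : ℕ) → Ω n → EuclideanSpace ℝ (Fin k)}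
  {Vhat : (n : ℕ) → Ω n → Matrix (Fin k) (Fin k) ℝ}
  {g : EuclideanSpace ℝ (Fin k) → ℝ}
  {G : EuclideanSpace ℝ (Fin k) → EuclideanSpace ℝ (Fin k)}
  {U : Set (EuclideanSpace ℝ (Fin k))}

/-- The probability that the interval covers the first coordinate of the true parameter. -/
noncomputable def coverage (α : ℝ) (P : (n : ℕ) → 𝔽 → Measure (Ω n))
    (θ : 𝔽 → EuclideanSpace ℝ (Fin k)) (θhat : (n : ℕ) → Ω n → EuclideanSpace ℝ (Fin k))
    (Vhat : (n : ℕ) → Ω n → Matrix (Fin k) (Fin k) ℝ) (g : EuclideanSpace ℝ (Fin k) → ℝ)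
    (G : EuclideanSpace ℝ (Fin k) → EuclideanSpace ℝ (Fin k)) (n : ℕ) (F : 𝔽) : ℝ≥0∞ :=
  P n F {ω | θ F 0 ∈ IICI α g G n (θhat n ω) (Vhat n ω)}

/-- Bounded gradients have a convergent subsequence, and the uniform lower bound `c` keeps the limit
from being parallel to `e1`. -/
lemma exists_subseq_gradient_tendsto
    (hU : ∀ F : ℕ → 𝔽, (∀ n, 1 ≤ n → F n ∈ 𝓕 n) →
      ∃ ε : ℝ, 0 < ε ∧ ∀ᶠ n in atTop, Metric.ball (θ (F n)) ε ⊆ U)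
    (hGspan : ∃ c : ℝ, 0 < c ∧ ∀ x ∈ U, c ≤ ‖(G x 0) • e1 - G x‖)
    (hGbdd : ∃ C : ℝ, ∀ x ∈ U, ‖G x‖ ≤ C) {F : ℕ → 𝔽} (hF : ∀ n, 1 ≤ n → F n ∈ 𝓕 n)
    {φ : ℕ → ℕ} (hφ : StrictMono φ) :
    ∃ ψ : ℕ → ℕ, StrictMono ψ ∧ ∃ a : EuclideanSpace ℝ (Fin k), 0 < ‖(a 0) • e1 - a‖ ∧
      Tendsto (fun q => G (θ (F (φ (ψ q))))) atTop (𝓝 a) := by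
  obtain ⟨ε, hε, hball⟩ := hU F hF
  obtain ⟨c, hc, hGc⟩ := hGspan
  obtain ⟨C, hGC⟩ := hGbdd
  have hmem : ∀ᶠ q in atTop, θ (F (φ q)) ∈ U := by
    filter_upwards [hφ.tendsto_atTop.eventually hball] with q hq
    exact hq (Metric.mem_ball_self hε)
  obtain ⟨a, -, ψ, hψ, ha⟩ := tendsto_subseq_of_frequently_bounded
    (Metric.isBounded_closedBall (x := (0 : EuclideanSpace ℝ (Fin k))) (r := C))
    (x := fun q => G (θ (F (φ q))))
    (hmem.mono fun q hq => by simpa using hGC _ hq).frequently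
  refine ⟨ψ, hψ, a, hc.trans_le ?_, ha⟩
  have hcont : Continuous fun x : EuclideanSpace ℝ (Fin k) => ‖(x 0) • e1 - x‖ := by fun_prop
  exact ge_of_tendsto ((hcont.tendsto a).comp ha)
    ((hψ.tendsto_atTop.eventually hmem).mono fun q hq => hGc _ hq)

/-- Every subsequence has a further subsequence along which the coverage probability converges, to
the nominal level or to the coverage probability of a limiting experiment. -/
lemma exists_subseq_coverage {α : ℝ} (hα0 : 0 < α) (hα1 : α < 1)
    (hVsymm : ∀ n ω, (Vhat n ω).IsSymm) (hAsy : AsympNormalAlongSubseq 𝓕 P θ θhat Vhat)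
    (hg : ∀ x ∈ U, HasGradientWithinAt g (G x) U x) (hGunif : UniformContinuousOn G U)
    (hU : ∀ F : ℕ → 𝔽, (∀ n, 1 ≤ n → F n ∈ 𝓕 n) →
      ∃ ε : ℝ, 0 < ε ∧ ∀ᶠ n in atTop, Metric.ball (θ (F n)) ε ⊆ U)
    (hGspan : ∃ c : ℝ, 0 < c ∧ ∀ x ∈ U, c ≤ ‖(G x 0) • e1 - G x‖)
    (hGbdd : ∃ C : ℝ, ∀ x ∈ U, ‖G x‖ ≤ C) {F : ℕ → 𝔽} (hF : ∀ n, 1 ≤ n → F n ∈ 𝓕 n)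
    {φ : ℕ → ℕ} (hφ : StrictMono φ) :
    ∃ ψ : ℕ → ℕ, StrictMono ψ ∧
      (∀ h : ℝ, h ≤ 0 → Tendsto (fun q => √(φ q : ℝ) * g (θ (F (φ q)))) atTop (𝓝 h) →
        ∃ r, ENNReal.ofReal (1 - α) ≤ r ∧ (h = 0 → r = ENNReal.ofReal (1 - α)) ∧
          Tendsto (fun q => coverage α P θ θhat Vhat g G (φ (ψ q)) (F (φ (ψ q)))) atTop (𝓝 r)) ∧
      (Tendsto (fun q => √(φ q : ℝ) * g (θ (F (φ q)))) atTop atBot →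
        Tendsto (fun q => coverage α P θ θhat Vhat g G (φ (ψ q)) (F (φ (ψ q)))) atTop
          (𝓝 (ENNReal.ofReal (1 - α)))) := by
  obtain ⟨ψ₁, hψ₁, a, ha0, ha⟩ := exists_subseq_gradient_tendsto hU hGspan hGbdd hF hφ
  obtain ⟨ψ₂, hψ₂, V, hV, hdist, hVhat⟩ := hAsy F hF (fun q => φ (ψ₁ q)) (hφ.comp hψ₁)
  obtain ⟨ε, hε, hball⟩ := hU F hF
  have hmono : StrictMono fun q => φ (ψ₁ (ψ₂ q)) := hφ.comp (hψ₁.comp hψ₂)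
  obtain ⟨hfin, hinf⟩ := tendsto_coverage (Ω := fun q => Ω (φ (ψ₁ (ψ₂ q))))
    (P := fun q => P (φ (ψ₁ (ψ₂ q))) (F (φ (ψ₁ (ψ₂ q))))) (N := fun q => φ (ψ₁ (ψ₂ q)))
    (θ := fun q => θ (F (φ (ψ₁ (ψ₂ q))))) (θhat := fun q => θhat (φ (ψ₁ (ψ₂ q))))
    (Vhat := fun q => Vhat (φ (ψ₁ (ψ₂ q)))) (g := g) (G := G) (U := U) (a := a)
    α hmono.tendsto_atTop hV (fun q => hVsymm _) hdist hVhat hg hGunif hε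
    (hmono.tendsto_atTop.eventually hball) (ha.comp hψ₂.tendsto_atTop) ha0
  refine ⟨fun q => ψ₁ (ψ₂ q), hψ₁.comp hψ₂, fun h hh hlim => ?_, fun hlim => ?_⟩
  · refine ⟨_, le_measure_limitMargin hV ha0 hα0 hα1 hh, ?_,
      hfin h (hlim.comp (hψ₁.comp hψ₂).tendsto_atTop)⟩
    rintro rfl
    exact measure_limitMargin_zero hV ha0 hα0 hα1
  · rw [← measure_usual_margin hV hα0 hα1]
    exact hinf (hlim.comp (hψ₁.comp hψ₂).tendsto_atTop)

/-- The extended real line is compact, and the upper bound 0 excludes the limit +∞. -/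
lemma exists_subseq_tendsto_real_or_atBot {u : ℕ → ℝ} (hu : ∀ n, u n ≤ 0) :
    ∃ χ : ℕ → ℕ, StrictMono χ ∧
      ((∃ h ≤ 0, Tendsto (u ∘ χ) atTop (𝓝 h)) ∨ Tendsto (u ∘ χ) atTop atBot) := by
  obtain ⟨y, χ, hχ, hy⟩ := CompactSpace.tendsto_subseq fun n => (u n : EReal)
  refine ⟨χ, hχ, ?_⟩
  have hy0 : y ≤ 0 := le_of_tendsto' hy fun n => EReal.coe_le_coe_iff.2 (hu (χ n))
  induction y with
  | bot => exact Or.inr (EReal.tendsto_coe_nhds_bot_iff.1 hy)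
  | coe h => exact Or.inl ⟨h, by exact_mod_cast hy0, EReal.tendsto_coe.1 hy⟩
  | top => simp at hy0

end Subsequences

end IneqCI

/-! ### The theorem, by contradiction and subsequences. -/

theorem theorem3 {k : ℕ} [NeZero k] (α : ℝ) (hα0 : 0 < α) (hα1 : α < 1)
    -- the model: sample spaces, parameter spaces, laws, true parameter, estimators
    {Ω : ℕ → Type*} [∀ n, MeasurableSpace (Ω n)] {𝔽 : Type*}
    (𝓕 : ℕ → Set 𝔽) (h𝓕 : ∀ n, 1 ≤ n → (𝓕 n).Nonempty)
    (P : (n : ℕ) → 𝔽 → Measure (Ω n)) [∀ n F, IsProbabilityMeasure (P n F)]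
    (θ : 𝔽 → EuclideanSpace ℝ (Fin k))
    (θhat : (n : ℕ) → Ω n → EuclideanSpace ℝ (Fin k))
    (Vhat : (n : ℕ) → Ω n → Matrix (Fin k) (Fin k) ℝ)
    (hθhat : ∀ n, Measurable (θhat n))
    (hVhat : ∀ n i j, Measurable fun ω => Vhat n ω i j)
    (hVsymm : ∀ n ω, (Vhat n ω).IsSymm)
    -- asymptotic normality and consistency along subsequences
    (hAsy : IneqCI.AsympNormalAlongSubseq 𝓕 P θ θhat Vhat)
    -- the inequality `g ≤ 0` and its gradient `G` on the set `U`
    (g : EuclideanSpace ℝ (Fin k) → ℝ)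
    (G : EuclideanSpace ℝ (Fin k) → EuclideanSpace ℝ (Fin k))
    (U : Set (EuclideanSpace ℝ (Fin k)))
    (hg : ∀ x ∈ U, HasGradientWithinAt g (G x) U x)
    (hGunif : UniformContinuousOn G U)
    (hU : ∀ F : ℕ → 𝔽, (∀ n, 1 ≤ n → F n ∈ 𝓕 n) →
      ∃ ε : ℝ, 0 < ε ∧ ∀ᶠ n in atTop, Metric.ball (θ (F n)) ε ⊆ U)
    (hGspan : ∃ c : ℝ, 0 < c ∧ ∀ x ∈ U, c ≤ ‖(G x 0) • IneqCI.e1 - G x‖)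
    (hGbdd : ∃ C : ℝ, ∀ x ∈ U, ‖G x‖ ≤ C) :
    ENNReal.ofReal (1 - α) ≤
        liminf (fun n : ℕ => ⨅ F ∈ {F ∈ 𝓕 n | g (θ F) ≤ 0},
          P n F {ω | θ F 0 ∈ IneqCI.IICI α g G n (θhat n ω) (Vhat n ω)}) atTop ∧
      ∀ F : ℕ → 𝔽, (∀ n, 1 ≤ n → F n ∈ 𝓕 n) →
        Tendsto (fun n : ℕ => √(n : ℝ) * g (θ (F n))) atTop (𝓝 0) →
        Tendsto (fun n : ℕ =>
            P n (F n) {ω | θ (F n) 0 ∈ IneqCI.IICI α g G n (θhat n ω) (Vhat n ω)})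
          atTop (𝓝 (ENNReal.ofReal (1 - α))) := by
  classical
  constructor
  · by_contra hlt
    obtain ⟨β, hβ1, hβ2⟩ := exists_between (not_le.1 hlt)
    have hfreq : ∃ᶠ n in atTop, 1 ≤ n ∧ ∃ F ∈ 𝓕 n, g (θ F) ≤ 0 ∧
        IneqCI.coverage α P θ θhat Vhat g G n F < β := by
      refine ((frequently_lt_of_liminf_lt (by isBoundedDefault) hβ1).and_eventually
        (eventually_ge_atTop 1)).mono ?_
      rintro n ⟨hn, hn1⟩
      -- An empty infimum is `⊤`, so an infimum below β provides an actual parameter.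
      simp only [iInf_lt_iff] at hn
      obtain ⟨F, ⟨hF1, hF2⟩, hF3⟩ := hn
      exact ⟨hn1, F, hF1, hF2, hF3⟩
    obtain ⟨φ, hφ, hbad⟩ := extraction_of_frequently_atTop hfreq
    -- The assumptions concern full sequences, so the bad parameters are completed by arbitrary
    -- elements of `𝓕 n`; at `n = 0`, where nothing is required, an element of `𝓕 1` serves.
    have hchoice : ∀ n : ℕ, ∃ F : 𝔽, (1 ≤ n → F ∈ 𝓕 n) ∧ ((∃ F ∈ 𝓕 n, g (θ F) ≤ 0 ∧
        IneqCI.coverage α P θ θhat Vhat g G n F < β) → g (θ F) ≤ 0 ∧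
        IneqCI.coverage α P θ θhat Vhat g G n F < β) := by
      intro n
      by_cases hn : ∃ F ∈ 𝓕 n, g (θ F) ≤ 0 ∧ IneqCI.coverage α P θ θhat Vhat g G n F < β
      · obtain ⟨F, h1, h2⟩ := hn
        exact ⟨F, fun _ => h1, fun _ => h2⟩
      · by_cases h1 : 1 ≤ n
        · obtain ⟨F, hF⟩ := h𝓕 n h1
          exact ⟨F, fun _ => hF, fun h => absurd h hn⟩
        · obtain ⟨F, -⟩ := h𝓕 1 le_rfl
          exact ⟨F, fun h => absurd h h1, fun h => absurd h hn⟩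
    choose F hF hFbad using hchoice
    obtain ⟨χ, hχ, hcases⟩ := IneqCI.exists_subseq_tendsto_real_or_atBot
      (u := fun q => √(φ q : ℝ) * g (θ (F (φ q)))) fun q =>
        mul_nonpos_of_nonneg_of_nonpos (Real.sqrt_nonneg _) (hFbad _ (hbad q).2).1
    obtain ⟨ψ, hψ, hfin, hinf⟩ := IneqCI.exists_subseq_coverage hα0 hα1 hVsymm hAsy hg hGunif hU
      hGspan hGbdd hF (hφ.comp hχ)
    obtain ⟨r, hr, hlim⟩ : ∃ r, ENNReal.ofReal (1 - α) ≤ r ∧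
        Tendsto (fun q => IneqCI.coverage α P θ θhat Vhat g G ((φ ∘ χ) (ψ q))
          (F ((φ ∘ χ) (ψ q)))) atTop (𝓝 r) := by
      rcases hcases with ⟨h, hh, hlim⟩ | hlim
      · obtain ⟨r, hr, -, hr'⟩ := hfin h hh hlim
        exact ⟨r, hr, hr'⟩
      · exact ⟨_, le_rfl, hinf hlim⟩
    have hle : r ≤ β := le_of_tendsto' hlim fun q => (hFbad _ (hbad (χ (ψ q))).2).2.le
    exact absurd hβ2 (not_lt.2 (hr.trans hle))
  · intro F hF hlim
    refine tendsto_of_subseq_tendsto fun ns hns => ?_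
    -- `ns` only tends to infinity; a strictly increasing subsequence is needed for the extraction.
    obtain ⟨χ, hχ, hmono⟩ := strictMono_subseq_of_tendsto_atTop hns
    obtain ⟨ψ, hψ, hfin, -⟩ := IneqCI.exists_subseq_coverage hα0 hα1 hVsymm hAsy hg hGunif hU
      hGspan hGbdd hF hmono
    obtain ⟨r, -, hr, hr'⟩ := hfin 0 le_rfl (hlim.comp hmono.tendsto_atTop)
    refine ⟨fun q => χ (ψ q), ?_⟩
    rw [hr rfl] at hr'
    exact hr'
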